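/- **Duality theorem.** Notation. $\mathbb D=\{t\in\mathbb C:|t|<1\}$, $\sigma$ is the rotation invariant probability measure on $\partial\mathbb D$, $P[h](t)=\int_{\partial\mathbb D}\frac{1-|t|^2}{|s-t|^2}\,h(s)\,d\sigma(s)$ is the Poisson extension of $h\in L^1(\partial\mathbb D)$, and $z\cdot w=\sum_j z_jw_j$ for $z,w\in\mathbb C^n$. For $r>1$, $H^r(\mathbb D,\mathbb C^n)$ is the Hardy space, that is, the space of the holomorphic functions among the Poisson extensions of functions in $L^r(\partial\mathbb D,\mathbb C^n)$; such a function is identified with its boundary values. The Legendre transform of $\varphi$ on $\mathbb C^n$ is $\varphi^*(z)=\sup_{w\in\mathbb C^n}\{\mathrm{Re}(z\cdot w)-\varphi(w)\}$. Let $1<p<\infty$ and let $\phi:\partial\mathbb D\times\mathbb C^n\to\mathbb R$ be Borel measurable, with $\phi_s=\phi(s,\cdot)$ convex for every $s\in\partial\mathbb D$, and satisfying the $p$-uniform growth condition: for some $c,C,A>0$, $$c|w|^p-A\le\phi_s(w)\le C|w|^p+A\qquad(s\in\partial\mathbb D,\ w\in\mathbb C^n).$$ For $u:\mathbb D\times\mathbb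 C^n\to\mathbb R$ write $u\preceq\phi$ if for almost every $s\in\partial\mathbb D$ and every $z\in\mathbb C^n$, $\limsup_{(0,1)\times\mathbb C^n\ni(r,w)\to(1,z)}u(rs,w)\le\phi(s,z)$. With $q=p/(p-1)$, define for $(t,w)\in\mathbb D\times\mathbb C^n$ $$\tilde\phi(t,w)=\sup\{L_{f_0,f}(t,w):f_0\in L^1(\partial\mathbb D,\mathbb C),\ f\in H^q(\mathbb D,\mathbb C^n),\ L_{f_0,f}\preceq\phi\},$$ where $L_{f_0,f}(t,w)=\mathrm{Re}(f(t)\cdot w)-P[\mathrm{Re}\,f_0](t)$, $$\hat\phi(t,w)=\sup\{u(t,w):u:\mathbb D\times\mathbb C^n\to\mathbb R\text{ plurisubharmonic},\ u(t',w')\le\sup_{s\in\partial\mathbb D}\phi(s,w')\text{ for all }(t',w'),\ u\preceq\phi\},$$ $$\check\phi(t,w)=\inf\{P[\phi(s,f(s))](t):f\in H^p(\mathbb D,\mathbb C^n),\ f(t)=w\}.$$ These three functions coincide on $\mathbb D\times\mathbb C^n$; their common value is the interpolated family $[\phi]_t(w)$, $t\in\mathbb D$. Let $\psi_s=(\phi_s)^*$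 for $s\in\partial\mathbb D$. Then the three functions $\tilde\psi,\hat\psi,\check\psi$, formed from $\psi$ with the exponents $p$ and $q$ interchanged, also coincide, and their common value $[\psi]$ satisfies, for every $t\in\mathbb D$, $$[\psi]_t=([\phi]_t)^*\qquad\text{on }\mathbb C^n.$$ -/

import Mathlib

open MeasureTheory Metric Set Filter Topology

noncomputable section

namespace Interp

/-- `ℂⁿ` with its Hermitian norm. -/
abbrev Cn (n : ℕ) : Type := EuclideanSpace ℂ (Fin n)

/-- The bilinear (not sesquilinear) product `z · w = ∑ zⱼ wⱼ`. -/
def dot {n : ℕ} (z w : Cn n) : ℂ := ∑ j, z j * w j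

instance instMeasurableSpaceCircle : MeasurableSpace Circle := borel Circle

instance instBorelSpaceCircle : BorelSpace Circle := ⟨rfl⟩

/-- The rotation invariant probability measure `dθ / 2π` on the unit circle. -/
def circleProb : Measure Circle :=
  (ENNReal.ofReal (2 * Real.pi))⁻¹ •
    (volume.restrict (Ioc 0 (2 * Real.pi))).map (fun θ : ℝ => Circle.exp θ)

/-- The Poisson extension `P[h](t) = ∫ (1 - |t|²) / |s - t|² h(s) dσ(s)`. -/
def poisson {F : Type*} [NormedAddCommGroup F] [NormedSpace ℝ F] (h : Circle → F) (t : ℂ) : F :=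
  ∫ s : Circle, poissonKernel 0 t (s : ℂ) • h s ∂circleProb

/-- `h` is the boundary function of an element of the Hardy space `H^p(𝔻, ℂⁿ)`, the space of the
holomorphic functions on the disc among the Poisson extensions of functions in `L^p`. The element
itself is `poisson h`, and it is identified with its boundary function `h`. -/
def IsHardy {n : ℕ} (p : ℝ) (h : Circle → Cn n) : Prop :=
  MemLp h (ENNReal.ofReal p) circleProb ∧ DifferentiableOn ℂ (poisson h) (ball 0 1)

/-- The `p`-uniform growth condition for `1 < p < ∞`. -/
def UniformGrowth {n : ℕ} (p : ℝ) (φ : Circle → Cn n → ℝ) : Prop :=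
  ∃ c C A : ℝ, 0 < c ∧ 0 < C ∧ 0 < A ∧
    ∀ s w, c * ‖w‖ ^ p - A ≤ φ s w ∧ φ s w ≤ C * ‖w‖ ^ p + A

/-- The Legendre transform `Φ*(z) = sup_w (Re (z · w) - Φ(w))`. -/
def legendre {n : ℕ} (Φ : Cn n → EReal) (z : Cn n) : EReal :=
  ⨆ w : Cn n, (((dot z w).re : ℝ) : EReal) - Φ w

/-- The fiberwise Legendre transform of real-valued boundary data. Under the growth condition the
supremum is finite, so that `EReal.toReal` loses nothing: see `coe_dualData`. -/
def dualData {n : ℕ} (φ : Circle → Cn n → ℝ) (s : Circle) (z : Cn n) : ℝ :=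
  (legendre (fun w => (φ s w : EReal)) z).toReal

/-- A real-valued function `u` is plurisubharmonic on the open set `Ω`: it is upper semicontinuous
and its composition with every analytic disc in `Ω` is subharmonic. As `u` does not take the value
`-∞`, integrability over circles is part of the sub-mean value property. -/
def IsPSH {X : Type*} [NormedAddCommGroup X] [NormedSpace ℂ X] (Ω : Set X) (u : X → ℝ) : Prop :=
  UpperSemicontinuousOn u Ω ∧
    ∀ g : ℂ → X, AnalyticOnNhd ℂ g (closedBall 0 1) → MapsTo g (closedBall 0 1) Ω →
      CircleIntegrable (fun τ => u (g τ)) 0 1 ∧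
        u (g 0) ≤ Real.circleAverage (fun τ => u (g τ)) 0 1

/-- `u ⪯ φ` on `∂𝔻 × ℂⁿ`: for almost every `s` and all `z`, the upper limit of `u(rs, w)` as
`(r, w) → (1, z)` with `r < 1` is at most `φ(s, z)`. -/
def BoundaryLE {n : ℕ} (u : ℂ → Cn n → ℝ) (φ : Circle → Cn n → ℝ) : Prop :=
  ∀ᵐ s : Circle ∂circleProb, ∀ z : Cn n,
    limsup (fun x : ℝ × Cn n => (u ((x.1 : ℂ) * (s : ℂ)) x.2 : EReal)) (𝓝[<] (1 : ℝ) ×ˢ 𝓝 z)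
      ≤ (φ s z : EReal)

/-- `L_{f₀,f}(t, w) = Re (f(t) · w) - P[Re f₀](t)`. -/
def linFun {n : ℕ} (f₀ : Circle → ℂ) (f : Circle → Cn n) (t : ℂ) (w : Cn n) : ℝ :=
  (dot (poisson f t) w).re - poisson (fun s => (f₀ s).re) t

/-- The polynomial-like hull (`φ` with a tilde): the supremum of `L_{f₀,f}(t, w)` over
`f₀ ∈ L¹` and `f ∈ H^q`, `q = p / (p - 1)`, with `L_{f₀,f} ⪯ φ`. -/
def linearEnvelope {n : ℕ} (p : ℝ) (φ : Circle → Cn n → ℝ) (t : ℂ) (w : Cn n) : EReal :=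
  sSup {x : EReal | ∃ (f₀ : Circle → ℂ) (f : Circle → Cn n),
    Integrable f₀ circleProb ∧ IsHardy (p / (p - 1)) f ∧ BoundaryLE (linFun f₀ f) φ ∧
      x = (linFun f₀ f t w : ℝ)}

/-- The upper (Perron-Bremermann) envelope (`φ` with a hat): the supremum of `u(t, w)` over all
plurisubharmonic `u : 𝔻 × ℂⁿ → ℝ` with `u(t, w) ≤ sup_s φ(s, w)` and `u ⪯ φ`. -/
def perronEnvelope {n : ℕ} (φ : Circle → Cn n → ℝ) (t : ℂ) (w : Cn n) : EReal :=
  sSup {x : EReal | ∃ u : ℂ → Cn n → ℝ,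
    IsPSH (ball (0 : ℂ) 1 ×ˢ (univ : Set (Cn n))) (fun y : ℂ × Cn n => u y.1 y.2) ∧
      (∀ t' ∈ ball (0 : ℂ) 1, ∀ w' : Cn n, (u t' w' : EReal) ≤ ⨆ s : Circle, (φ s w' : EReal)) ∧
      BoundaryLE u φ ∧ x = (u t w : ℝ)}

/-- The envelope by holomorphic discs (`φ` with a check): the infimum of `P[φ(s, f(s))](t)` over
`f ∈ H^p` with `f(t) = w`. -/
def discEnvelope {n : ℕ} (p : ℝ) (φ : Circle → Cn n → ℝ) (t : ℂ) (w : Cn n) : EReal :=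
  sInf {x : EReal | ∃ f : Circle → Cn n,
    IsHardy p f ∧ poisson f t = w ∧ x = (poisson (fun s => φ s (f s)) t : ℝ)}

/-- `Φ` is the interpolated family `[φ]`, the common value on `𝔻 × ℂⁿ` of the three envelopes. -/
def IsInterpolant {n : ℕ} (p : ℝ) (φ : Circle → Cn n → ℝ) (Φ : ℂ → Cn n → EReal) : Prop :=
  ∀ t ∈ ball (0 : ℂ) 1, ∀ w : Cn n,
    Φ t w = linearEnvelope p φ t w ∧ Φ t w = perronEnvelope φ t w ∧ Φ t w = discEnvelope p φ t w

theorem coe_dualData {n : ℕ} {p : ℝ} (hp : 1 < p) {φ : Circle → Cn n → ℝ}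
    (hφ : UniformGrowth p φ) (s : Circle) (z : Cn n) :
    (dualData φ s z : EReal) = legendre (fun w => (φ s w : EReal)) z := by
  obtain ⟨c, C, A, hc, -, -, h⟩ := hφ
  have hp0 : 0 < p := by linarith
  have hpq := Real.HolderConjugate.conjExponent hp
  set K : ℝ := ∑ j, ‖z j‖ with hK
  have hK0 : 0 ≤ K := Finset.sum_nonneg fun j _ => norm_nonneg _
  set e : ℝ := (c * p) ^ (1 / p) with he
  have he0 : 0 < e := Real.rpow_pos_of_pos (by positivity) _
  have hep : e ^ p = c * p := by
    rw [he, ← Real.rpow_mul (by positivity), one_div_mul_cancel hp0.ne', Real.rpow_one]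
  have hdot : ∀ w : Cn n, (dot z w).re ≤ K * ‖w‖ := fun w => by
    refine (Complex.re_le_norm _).trans ((norm_sum_le _ _).trans ?_)
    rw [hK, Finset.sum_mul]
    refine Finset.sum_le_sum fun j _ => ?_
    rw [norm_mul]
    exact mul_le_mul_of_nonneg_left (PiLp.norm_apply_le w j) (norm_nonneg _)
  have hub : ∀ w : Cn n, (dot z w).re - φ s w ≤
      (K / e) ^ p.conjExponent / p.conjExponent + A := fun w => by
    have h1 := Real.young_inequality_of_nonneg (a := e * ‖w‖) (b := K / e)
      (by positivity) (by positivity) hpq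
    rw [Real.mul_rpow he0.le (norm_nonneg _), hep] at h1
    have h2 : e * ‖w‖ * (K / e) = K * ‖w‖ := by field_simp
    have h3 : c * p * ‖w‖ ^ p / p = c * ‖w‖ ^ p := by field_simp
    rw [h2, h3] at h1
    have := (h s w).1
    have := hdot w
    linarith
  refine EReal.coe_toReal (ne_of_lt ?_) (ne_of_gt ?_)
  · refine lt_of_le_of_lt (iSup_le fun w => ?_) (EReal.coe_lt_top
      ((K / e) ^ p.conjExponent / p.conjExponent + A))
    rw [← EReal.coe_sub]
    exact EReal.coe_le_coe_iff.2 (hub w)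
  · refine lt_of_lt_of_le ?_ (le_iSup _ (0 : Cn n))
    rw [← EReal.coe_sub]
    exact EReal.bot_lt_coe _

end Interp

end

namespace Interp

/-- The extension of a function on the circle to the plane, constant along rays. -/
noncomputable def radialExt {F : Type*} (h : Circle → F) (z : ℂ) : F := h (Circle.exp z.arg)

@[simp] theorem radialExt_coe {F : Type*} (h : Circle → F) (s : Circle) : radialExt h s = h s := by
  simp [radialExt, Circle.exp_arg]

section CircleMeasure

variable {F G : Type*} [NormedAddCommGroup F] [NormedSpace ℝ F] [NormedAddCommGroup G]
  [NormedSpace ℝ G]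

theorem continuous_coe_circle : Continuous (fun s : Circle => (s : ℂ)) := continuous_subtype_val

theorem measurable_circleExp : Measurable (fun θ : ℝ => Circle.exp θ) :=
  Circle.exp.continuous.measurable

theorem two_pi_pos_real : (0 : ℝ) < 2 * Real.pi := by positivity

instance isProbabilityMeasure_circleProb : IsProbabilityMeasure circleProb := by
  constructor
  rw [circleProb, Measure.smul_apply, Measure.map_apply measurable_circleExp MeasurableSet.univ,
    preimage_univ, Measure.restrict_apply_univ, Real.volume_Ioc, sub_zero, smul_eq_mul]
  exact ENNReal.inv_mul_cancel (by simp [Real.pi_pos]) ENNReal.ofReal_ne_top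

theorem aestronglyMeasurable_circleProb {F : Type*} [NormedAddCommGroup F] {h : Circle → F} :
    AEStronglyMeasurable h circleProb ↔ AEStronglyMeasurable h
      ((volume.restrict (Ioc 0 (2 * Real.pi))).map (fun θ : ℝ => Circle.exp θ)) := by
  have h0 : (ENNReal.ofReal (2 * Real.pi))⁻¹ ≠ 0 := ENNReal.inv_ne_zero.2 ENNReal.ofReal_ne_top
  constructor
  · intro H
    exact H.mono_ac ((Measure.absolutelyContinuous_smul h0))
  · intro H
    exact H.mono_ac (Measure.smul_absolutelyContinuous)

theorem integral_circleProb {h : Circle → F} (hh : AEStronglyMeasurable h circleProb) :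
    ∫ s, h s ∂circleProb = (2 * Real.pi)⁻¹ • ∫ θ in (0 : ℝ)..2 * Real.pi, h (Circle.exp θ) := by
  rw [circleProb, integral_smul_measure, integral_map measurable_circleExp.aemeasurable
    (aestronglyMeasurable_circleProb.1 hh), intervalIntegral.integral_of_le two_pi_pos_real.le]
  congr 1
  rw [ENNReal.toReal_inv, ENNReal.toReal_ofReal two_pi_pos_real.le]

theorem integrable_circleProb {F : Type*} [NormedAddCommGroup F] {h : Circle → F} (hh : AEStronglyMeasurable h circleProb) :
    Integrable h circleProb ↔
      IntervalIntegrable (fun θ => h (Circle.exp θ)) volume 0 (2 * Real.pi) := by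
  rw [circleProb, integrable_smul_measure (ENNReal.inv_ne_zero.2 ENNReal.ofReal_ne_top) (by simp [Real.pi_pos]),
    integrable_map_measure (aestronglyMeasurable_circleProb.1 hh)
      measurable_circleExp.aemeasurable,
    intervalIntegrable_iff_integrableOn_Ioc_of_le two_pi_pos_real.le]
  rfl

theorem ae_circleProb {P : Circle → Prop} (h : ∀ᵐ θ : ℝ, P (Circle.exp θ)) :
    ∀ᵐ s ∂circleProb, P s := by
  have h0 : ∀ᵐ s ∂((volume.restrict (Ioc 0 (2 * Real.pi))).map (fun θ : ℝ => Circle.exp θ)),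
      P s := by
    obtain ⟨N, hPN, hN, hN0⟩ := exists_measurable_superset_of_null (ae_iff.1 h)
    have hm : Measurable (fun s : Circle => (s : ℂ).arg) :=
      Complex.measurable_arg.comp continuous_coe_circle.measurable
    refine ae_iff.2 (measure_mono_null (t := {s : Circle | (s : ℂ).arg ∈ N}) (fun s hs => ?_) ?_)
    · refine hPN ?_
      simpa [Circle.exp_arg] using hs
    · change Measure.map _ _ ((fun s : Circle => (s : ℂ).arg) ⁻¹' N) = 0
      rw [Measure.map_apply measurable_circleExp (hm hN), Measure.restrict_apply
        (measurable_circleExp (hm hN))]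
      refine measure_mono_null (t := N ∪ (fun θ => θ - 2 * Real.pi) ⁻¹' N) ?_
        (measure_union_null hN0 ?_)
      · rintro θ ⟨hθ, h1, h2⟩
        simp only [mem_preimage] at hθ
        rcases le_or_gt θ Real.pi with h3 | h3
        · rw [Circle.arg_exp (by linarith [Real.pi_pos]) h3] at hθ
          exact Or.inl hθ
        · right
          have : Circle.exp θ = Circle.exp (θ - 2 * Real.pi) := (Circle.exp_sub_two_pi θ).symm
          rw [this, Circle.arg_exp (by linarith) (by linarith [Real.pi_pos])] at hθ
          exact hθ
      · rw [(measurePreserving_sub_right volume (2 * Real.pi)).measure_preimage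
          hN.nullMeasurableSet]
        exact hN0
  exact (Measure.smul_absolutelyContinuous).ae_le h0

theorem circleMap_eq_coe_exp (θ : ℝ) : circleMap 0 1 θ = (Circle.exp θ : ℂ) := by
  simp [circleMap_zero]

theorem circleAverage_eq_integral {H : ℂ → F}
    (hH : AEStronglyMeasurable (fun s : Circle => H s) circleProb) :
    Real.circleAverage H 0 1 = ∫ s : Circle, H s ∂circleProb := by
  rw [integral_circleProb hH, Real.circleAverage_def]
  simp only [circleMap_eq_coe_exp]

theorem circleIntegrable_iff {F : Type*} [NormedAddCommGroup F] {H : ℂ → F}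
    (hH : AEStronglyMeasurable (fun s : Circle => H s) circleProb) :
    CircleIntegrable H 0 1 ↔ Integrable (fun s : Circle => H s) circleProb := by
  rw [integrable_circleProb hH, CircleIntegrable]
  simp only [circleMap_eq_coe_exp]

theorem norm_circle (s : Circle) : ‖(s : ℂ)‖ = 1 := Circle.norm_coe s

end CircleMeasure

section PoissonKernel

variable {t : ℂ}

theorem poissonKernel_zero_apply (t : ℂ) (s : Circle) :
    poissonKernel 0 t s = (1 - ‖t‖ ^ 2) / ‖(s : ℂ) - t‖ ^ 2 := by
  simp [poissonKernel_def, norm_circle]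

theorem coe_sub_ne_zero (ht : t ∈ ball (0 : ℂ) 1) (s : Circle) : (s : ℂ) - t ≠ 0 := by
  intro h
  rw [sub_eq_zero] at h
  rw [← h] at ht
  simp [norm_circle] at ht

theorem poissonKernel_pos (ht : t ∈ ball (0 : ℂ) 1) (s : Circle) : 0 < poissonKernel 0 t s := by
  rw [poissonKernel_zero_apply]
  have := norm_pos_iff.2 (coe_sub_ne_zero ht s)
  have h1 : ‖t‖ < 1 := by simpa using ht
  have : 0 < 1 - ‖t‖ ^ 2 := by nlinarith [norm_nonneg t]
  positivity

theorem poissonKernel_le (ht : t ∈ ball (0 : ℂ) 1) (s : Circle) :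
    poissonKernel 0 t s ≤ 2 / (1 - ‖t‖) := by
  rw [poissonKernel_zero_apply]
  have h1 : ‖t‖ < 1 := by simpa using ht
  have h2 : 1 - ‖t‖ ≤ ‖(s : ℂ) - t‖ := by
    have := norm_sub_norm_le (s : ℂ) t
    rwa [norm_circle] at this
  have h3 : 0 < 1 - ‖t‖ := by linarith
  rw [div_le_div_iff₀ (by have := h3.trans_le h2; positivity) h3]
  nlinarith [norm_nonneg t, mul_le_mul h2 h2 h3.le (by linarith)]

theorem continuous_poissonKernel (ht : t ∈ ball (0 : ℂ) 1) :
    Continuous (fun s : Circle => poissonKernel 0 t s) := by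
  simp only [poissonKernel_zero_apply]
  refine continuous_const.div (by fun_prop) fun s => ?_
  have := norm_pos_iff.2 (coe_sub_ne_zero ht s)
  positivity

theorem continuousAt_poissonKernel (ht : t ∈ ball (0 : ℂ) 1) (s : Circle) :
    ContinuousAt (fun t : ℂ => poissonKernel 0 t s) t := by
  simp only [poissonKernel_zero_apply]
  refine ContinuousAt.div (by fun_prop) (by fun_prop) ?_
  have := norm_pos_iff.2 (coe_sub_ne_zero ht s)
  positivity

end PoissonKernel

section Poisson

variable {F G : Type*} [NormedAddCommGroup F] [NormedSpace ℝ F] [NormedAddCommGroup G]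
  [NormedSpace ℝ G] {t : ℂ}

theorem integrable_poissonKernel_smul (ht : t ∈ ball (0 : ℂ) 1) {h : Circle → F}
    (hh : Integrable h circleProb) :
    Integrable (fun s : Circle => poissonKernel 0 t s • h s) circleProb := by
  refine hh.bdd_smul (2 / (1 - ‖t‖)) (continuous_poissonKernel ht).aestronglyMeasurable ?_
  filter_upwards with s
  rw [Real.norm_of_nonneg (poissonKernel_pos ht s).le]
  exact poissonKernel_le ht s

theorem integrable_poissonKernel (ht : t ∈ ball (0 : ℂ) 1) :
    Integrable (fun s : Circle => poissonKernel 0 t s) circleProb := by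
  simpa using integrable_poissonKernel_smul ht (integrable_const (1 : ℝ))

theorem poisson_add (ht : t ∈ ball (0 : ℂ) 1) {h k : Circle → F}
    (hh : Integrable h circleProb) (hk : Integrable k circleProb) :
    poisson (fun s => h s + k s) t = poisson h t + poisson k t := by
  simp only [poisson, smul_add]
  exact integral_add (integrable_poissonKernel_smul ht hh) (integrable_poissonKernel_smul ht hk)

theorem poisson_sub (ht : t ∈ ball (0 : ℂ) 1) {h k : Circle → F}
    (hh : Integrable h circleProb) (hk : Integrable k circleProb) :
    poisson (fun s => h s - k s) t = poisson h t - poisson k t := by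
  simp only [poisson, smul_sub]
  exact integral_sub (integrable_poissonKernel_smul ht hh) (integrable_poissonKernel_smul ht hk)

theorem poisson_clm [CompleteSpace F] [CompleteSpace G] (ht : t ∈ ball (0 : ℂ) 1)
    (L : F →L[ℝ] G) {h : Circle → F}
    (hh : Integrable h circleProb) : poisson (fun s => L (h s)) t = L (poisson h t) := by
  simp only [poisson]
  rw [← L.integral_comp_comm (integrable_poissonKernel_smul ht hh)]
  simp

theorem poisson_mono (ht : t ∈ ball (0 : ℂ) 1) {h k : Circle → ℝ}
    (hh : Integrable h circleProb) (hk : Integrable k circleProb)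
    (hle : ∀ᵐ s ∂circleProb, h s ≤ k s) : poisson h t ≤ poisson k t := by
  refine integral_mono_ae (integrable_poissonKernel_smul ht hh)
    (integrable_poissonKernel_smul ht hk) ?_
  filter_upwards [hle] with s hs
  exact mul_le_mul_of_nonneg_left hs (poissonKernel_pos ht s).le

theorem poisson_congr_ae {h k : Circle → F} (hle : h =ᵐ[circleProb] k) :
    poisson h t = poisson k t := by
  refine integral_congr_ae ?_
  filter_upwards [hle] with s hs
  rw [hs]

theorem poisson_of_diffContOnCl {E : Type*} [NormedAddCommGroup E] [NormedSpace ℂ E]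
    [CompleteSpace E] {H : ℂ → E} (hH : DiffContOnCl ℂ H (ball 0 1))
    (ht : t ∈ ball (0 : ℂ) 1) : poisson (fun s => H s) t = H t := by
  have hc : Continuous (fun s : Circle => H s) :=
    hH.continuousOn_ball.comp_continuous continuous_coe_circle fun s => by simp [norm_circle]
  rw [← hH.circleAverage_poissonKernel_smul ht, circleAverage_eq_integral]
  · rfl
  · exact ((continuous_poissonKernel ht).smul hc).aestronglyMeasurable

theorem poisson_const [CompleteSpace F] (ht : t ∈ ball (0 : ℂ) 1) (x : F) :
    poisson (fun _ => x) t = x := by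
  have h : poisson (fun _ => (1 : ℂ)) t = 1 :=
    poisson_of_diffContOnCl (H := fun _ => 1) diffContOnCl_const ht
  have h1 : ∫ s : Circle, poissonKernel 0 t (s : ℂ) ∂circleProb = 1 := by
    have : (∫ s : Circle, ((poissonKernel 0 t (s : ℂ) : ℝ) : ℂ) ∂circleProb) = 1 := by
      rw [← h]; simp [poisson]
    rw [integral_complex_ofReal] at this
    exact_mod_cast this
  rw [poisson, integral_smul_const, h1, one_smul]

theorem integral_poissonKernel (ht : t ∈ ball (0 : ℂ) 1) :
    ∫ s : Circle, poissonKernel 0 t (s : ℂ) ∂circleProb = 1 := by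
  simpa [poisson] using poisson_const ht (1 : ℝ)

end Poisson

section Herglotz

variable {E : Type*} [NormedAddCommGroup E] [NormedSpace ℂ E] {t : ℂ}

theorem herglotzRieszKernel_zero_apply (t : ℂ) (s : Circle) :
    herglotzRieszKernel 0 t s = ((s : ℂ) + t) / (s - t) := by
  simp [herglotzRieszKernel_def]

theorem continuous_herglotzRieszKernel (ht : t ∈ ball (0 : ℂ) 1) :
    Continuous (fun s : Circle => herglotzRieszKernel 0 t s) := by
  simp only [herglotzRieszKernel_zero_apply]
  exact Continuous.div (by fun_prop) (by fun_prop) (coe_sub_ne_zero ht)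

theorem integrable_continuous_smul {𝕜 F : Type*} [NormedField 𝕜] [NormedAddCommGroup F]
    [NormedSpace 𝕜 F] {c : Circle → 𝕜} (hc : Continuous c) {g : Circle → F}
    (hg : Integrable g circleProb) : Integrable (fun s => c s • g s) circleProb := by
  obtain ⟨B, hB⟩ := isCompact_univ.exists_bound_of_continuousOn hc.continuousOn
  exact hg.bdd_smul B hc.aestronglyMeasurable (Eventually.of_forall fun s => hB s (mem_univ s))

theorem poissonKernel_eq_re (t : ℂ) (s : Circle) :
    poissonKernel 0 t s = (herglotzRieszKernel 0 t s).re := by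
  rw [poissonKernel_eq_re_herglotzRieszKernel]; rfl

theorem differentiableOn_integral_herglotz {g : Circle → E} (hg : Integrable g circleProb) :
    DifferentiableOn ℂ (fun t => ∫ s : Circle, herglotzRieszKernel 0 t s • g s ∂circleProb)
      (ball 0 1) := by
  have hi : CircleIntegrable (radialExt g) 0 1 := by
    rw [circleIntegrable_iff] <;> simp only [radialExt_coe]
    exacts [hg, hg.1]
  refine (differentiableOn_circleAverage_herglotzRieszKernel_smul hi).congr fun t ht => ?_
  rw [circleAverage_eq_integral] <;> simp only [radialExt_coe]
  exact (integrable_continuous_smul (continuous_herglotzRieszKernel ht) hg).1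

/-- The Herglotz representation of the Poisson extension of a real function. -/
theorem exists_differentiableOn_re_eq_poisson {h : Circle → ℝ} (hh : Integrable h circleProb) :
    ∃ H : ℂ → ℂ, DifferentiableOn ℂ H (ball 0 1) ∧
      ∀ t ∈ ball (0 : ℂ) 1, poisson h t = (H t).re := by
  refine ⟨_, differentiableOn_integral_herglotz (E := ℂ) hh.ofReal, fun t ht => ?_⟩
  have hi := integrable_continuous_smul (continuous_herglotzRieszKernel ht) (hh.ofReal (𝕜 := ℂ))
  have := integral_re hi
  simp only [RCLike.re_to_complex] at this
  rw [poisson]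
  refine Eq.trans ?_ this
  congr with s
  simp [poissonKernel_eq_re]

theorem herglotz_conj (ht : t ∈ ball (0 : ℂ) 1) (s : Circle) :
    HasSum (fun k : ℕ => (2 * (starRingEnd ℂ) t ^ (k + 1)) * (s : ℂ) ^ (k + 1))
      ((starRingEnd ℂ) (herglotzRieszKernel 0 t s) - 1) := by
  have h1 : ‖(starRingEnd ℂ) t * (s : ℂ)‖ < 1 := by
    rw [norm_mul, norm_circle, mul_one, RCLike.norm_conj]; simpa using ht
  have h2 := (hasSum_geometric_of_norm_lt_one h1).mul_left (2 * ((starRingEnd ℂ) t * (s : ℂ)))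
  have h8 : (fun k : ℕ => (2 * (starRingEnd ℂ) t ^ (k + 1)) * (s : ℂ) ^ (k + 1)) =
      fun k : ℕ => 2 * ((starRingEnd ℂ) t * (s : ℂ)) * ((starRingEnd ℂ) t * (s : ℂ)) ^ k := by
    ext k; ring
  rw [h8]
  suffices heq : (starRingEnd ℂ) (herglotzRieszKernel 0 t s) - 1 =
      2 * ((starRingEnd ℂ) t * (s : ℂ)) * (1 - (starRingEnd ℂ) t * (s : ℂ))⁻¹ by
    rw [heq]; exact h2
  have h3 : (starRingEnd ℂ) (s : ℂ) = (s : ℂ)⁻¹ := by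
    rw [← Circle.coe_inv_eq_conj, Circle.coe_inv]
  have h4 : (s : ℂ) ≠ 0 := Circle.coe_ne_zero s
  have h5 : 1 - (starRingEnd ℂ) t * (s : ℂ) ≠ 0 := by
    intro h
    rw [sub_eq_zero] at h
    rw [← h] at h1
    simp at h1
  rw [herglotzRieszKernel_zero_apply, map_div₀, map_add, map_sub, h3]
  have h6 : (s : ℂ)⁻¹ - (starRingEnd ℂ) t ≠ 0 := by
    intro h
    apply h5
    field_simp at h
    rw [mul_comm]; simpa using h
  field_simp
  have h7 : 1 - (s : ℂ) * (starRingEnd ℂ) t ≠ 0 := by rwa [mul_comm]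
  rw [eq_div_iff h7]
  field_simp
  ring

theorem integral_conj_herglotz_smul [CompleteSpace E] (ht : t ∈ ball (0 : ℂ) 1) {g : Circle → E}
    (hg : Integrable g circleProb)
    (hmom : ∀ k : ℕ, ∫ s : Circle, (s : ℂ) ^ (k + 1) • g s ∂circleProb = 0) :
    ∫ s : Circle, ((starRingEnd ℂ) (herglotzRieszKernel 0 t s) - 1) • g s ∂circleProb = 0 := by
  have h1 : ‖t‖ < 1 := by simpa using ht
  have h2 := hasSum_integral_of_dominated_convergence (μ := circleProb)
    (F := fun (k : ℕ) (s : Circle) =>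
      ((2 * (starRingEnd ℂ) t ^ (k + 1)) * (s : ℂ) ^ (k + 1)) • g s)
    (f := fun s : Circle => ((starRingEnd ℂ) (herglotzRieszKernel 0 t s) - 1) • g s)
    (fun k s => (2 * ‖t‖ ^ (k + 1)) * ‖g s‖) ?_ ?_ ?_ ?_ ?_
  · refine h2.unique ?_
    have : ∀ k : ℕ, ∫ s : Circle, ((2 * (starRingEnd ℂ) t ^ (k + 1)) * (s : ℂ) ^ (k + 1)) • g s
        ∂circleProb = 0 := fun k => by
      simp only [mul_smul (2 * (starRingEnd ℂ) t ^ (k + 1)), integral_smul, hmom, smul_zero]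
    simp only [this]
    exact hasSum_zero
  · intro k
    exact (Continuous.aestronglyMeasurable (by fun_prop)).smul hg.1
  · intro k
    filter_upwards with s
    rw [norm_smul]
    simp [norm_circle]
  · filter_upwards with s
    have := (summable_geometric_of_lt_one (norm_nonneg t) h1).mul_left (2 * ‖t‖)
    refine (this.congr fun k => ?_).mul_right _
    ring
  · simp only [tsum_mul_right]
    exact hg.norm.const_mul _
  · filter_upwards with s
    exact (herglotz_conj ht s).smul_const (g s)

/-- A function whose negative Fourier coefficients vanish has a holomorphic Poisson extension. -/
theorem differentiableOn_poisson [CompleteSpace E] {g : Circle → E} (hg : Integrable g circleProb)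
    (hmom : ∀ k : ℕ, ∫ s : Circle, (s : ℂ) ^ (k + 1) • g s ∂circleProb = 0) :
    DifferentiableOn ℂ (poisson g) (ball 0 1) := by
  have h1 : DifferentiableOn ℂ (fun t => (2 : ℂ)⁻¹ • ((∫ s : Circle, herglotzRieszKernel 0 t s •
      g s ∂circleProb) + ∫ s, g s ∂circleProb)) (ball 0 1) :=
    ((differentiableOn_integral_herglotz hg).add_const _).const_smul _
  refine h1.congr fun t ht => ?_
  have hc := continuous_herglotzRieszKernel ht
  have i1 := integrable_continuous_smul hc hg
  have hc2 : Continuous (fun s : Circle => (starRingEnd ℂ) (herglotzRieszKernel 0 t s) - 1) :=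
    (Complex.continuous_conj.comp hc).sub continuous_const
  have i2 := integrable_continuous_smul hc2 hg
  rw [← add_zero (∫ s : Circle, herglotzRieszKernel 0 t s • g s ∂circleProb),
    ← integral_conj_herglotz_smul ht hg hmom, ← integral_add i1 i2]
  have i3 : Integrable (fun s : Circle => herglotzRieszKernel 0 t s • g s +
    ((starRingEnd ℂ) (herglotzRieszKernel 0 t s) - 1) • g s) circleProb := i1.add i2
  rw [← integral_add i3 hg, ← integral_smul, poisson]
  congr with s
  rw [poissonKernel_eq_re, ← Complex.coe_smul, Complex.re_eq_add_conj]
  module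

end Herglotz

section Hardy

variable {n : ℕ} {p : ℝ} {t : ℂ}

theorem MemLp.integrable_of_one_lt {F : Type*} [NormedAddCommGroup F] (hp : 1 < p)
    {f : Circle → F} (hf : MemLp f (ENNReal.ofReal p) circleProb) : Integrable f circleProb :=
  hf.integrable (by rw [← ENNReal.ofReal_one]; exact ENNReal.ofReal_le_ofReal hp.le)

theorem IsHardy.integrable (hp : 1 < p) {f : Circle → Cn n} (hf : IsHardy p f) :
    Integrable f circleProb := MemLp.integrable_of_one_lt hp hf.1

theorem isHardy_of_differentiable {H : ℂ → Cn n} (hH : Differentiable ℂ H) :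
    IsHardy p (fun s => H s) := by
  have hc : Continuous (fun s : Circle => H s) := hH.continuous.comp continuous_coe_circle
  refine ⟨?_, hH.differentiableOn.congr fun t ht => ?_⟩
  · obtain ⟨B, hB⟩ := isCompact_univ.exists_bound_of_continuousOn hc.continuousOn
    exact MemLp.of_bound hc.aestronglyMeasurable B
      (Eventually.of_forall fun s => hB s (mem_univ s))
  · exact poisson_of_diffContOnCl hH.diffContOnCl ht

theorem IsHardy.add (hp : 1 < p) {f g : Circle → Cn n} (hf : IsHardy p f) (hg : IsHardy p g) :
    IsHardy p (fun s => f s + g s) :=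
  ⟨hf.1.add hg.1, (hf.2.add hg.2).congr fun _ ht =>
    poisson_add ht (hf.integrable hp) (hg.integrable hp)⟩

theorem poisson_const_smul {F : Type*} [NormedAddCommGroup F] [NormedSpace ℝ F] (c : ℝ)
    (f : Circle → F) : poisson (fun s => c • f s) t = c • poisson f t := by
  simp only [poisson, ← integral_smul, smul_comm c]

theorem IsHardy.const_smul (c : ℝ) {f : Circle → Cn n} (hf : IsHardy p f) :
    IsHardy p (fun s => c • f s) :=
  ⟨hf.1.const_smul c, (hf.2.const_smul c).congr fun _ _ => poisson_const_smul c f⟩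

end Hardy

section RadialKernel

/-- If the means of `g ≥ 0` over small balls centred at `θ` are at most `ε`, so is its mean with
respect to a radially decreasing kernel. -/
theorem lintegral_mul_le_of_radial {θ δ : ℝ} {ε : ENNReal} {K : ℝ → ℝ} {g : ℝ → ENNReal}
    (hK : Continuous K) (hK0 : ∀ y, 0 ≤ K y)
    (hmono : ∀ x ∈ closedBall θ δ, ∀ y ∈ closedBall θ δ, dist x θ ≤ dist y θ → K y ≤ K x)
    (hg : AEMeasurable g (volume.restrict (closedBall θ δ)))
    (hmean : ∀ ρ ∈ Ioc 0 δ, ∫⁻ y in closedBall θ ρ, g y ≤ ε * volume (closedBall θ ρ)) :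
    ∫⁻ y in closedBall θ δ, ENNReal.ofReal (K y) * g y ≤
      ε * ∫⁻ y in closedBall θ δ, ENNReal.ofReal (K y) := by
  have h1 : ∫⁻ y in closedBall θ δ, ENNReal.ofReal (K y) * g y =
      ∫⁻ y, ENNReal.ofReal (K y) ∂((volume.restrict (closedBall θ δ)).withDensity g) := by
    rw [lintegral_withDensity_eq_lintegral_mul₀ hg (by fun_prop)]
    simp [mul_comm]
  rw [h1, lintegral_eq_lintegral_meas_le _ (Eventually.of_forall hK0) hK.aemeasurable,
    lintegral_eq_lintegral_meas_le _ (Eventually.of_forall hK0) hK.aemeasurable,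
    ← lintegral_const_mul _ ?_]
  swap
  · exact Antitone.measurable fun a b hab => measure_mono fun y (hy : b ≤ K y) => hab.trans hy
  refine lintegral_mono fun a => ?_
  have hcl : IsClosed {y | a ≤ K y} := isClosed_le continuous_const hK
  rw [withDensity_apply _ hcl.measurableSet, Measure.restrict_restrict hcl.measurableSet,
    Measure.restrict_apply hcl.measurableSet]
  have hcomp : IsCompact ({y | a ≤ K y} ∩ closedBall θ δ) :=
    (isCompact_closedBall θ δ).inter_left hcl
  rcases ({y | a ≤ K y} ∩ closedBall θ δ).eq_empty_or_nonempty with he | hne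
  · simp [he]
  obtain ⟨x, hx, hmax⟩ := hcomp.exists_isMaxOn hne
    (continuous_id.dist continuous_const : Continuous fun y : ℝ => dist y θ).continuousOn
  have hS : {y | a ≤ K y} ∩ closedBall θ δ = closedBall θ (dist x θ) := by
    ext y
    constructor
    · intro hy
      exact hmax hy
    · intro hy
      have hy' : y ∈ closedBall θ δ := closedBall_subset_closedBall hx.2 hy
      exact ⟨le_trans (show a ≤ K x from hx.1) (hmono y hy' x hx.2 hy), hy'⟩
  rw [hS]
  rcases (dist_nonneg : 0 ≤ dist x θ).eq_or_lt with h0 | h0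
  · rw [← h0]
    have : volume (closedBall θ 0) = 0 := by simp
    rw [setLIntegral_measure_zero _ _ this]
    simp
  · exact hmean _ ⟨h0, hx.2⟩

/-- Real version of `lintegral_mul_le_of_radial`. -/
theorem integral_mul_le_of_radial {θ δ ε : ℝ} (hε : 0 ≤ ε) {K g : ℝ → ℝ}
    (hK : Continuous K) (hK0 : ∀ y, 0 ≤ K y) (hg0 : ∀ y, 0 ≤ g y)
    (hmono : ∀ x ∈ closedBall θ δ, ∀ y ∈ closedBall θ δ, dist x θ ≤ dist y θ → K y ≤ K x)
    (hg : IntegrableOn g (closedBall θ δ))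
    (hmean : ∀ ρ ∈ Ioc 0 δ, ∫ y in closedBall θ ρ, g y ≤ ε * (2 * ρ)) :
    ∫ y in closedBall θ δ, K y * g y ≤ ε * ∫ y in closedBall θ δ, K y := by
  have hKi : IntegrableOn K (closedBall θ δ) :=
    hK.continuousOn.integrableOn_compact (isCompact_closedBall θ δ)
  have h1 := lintegral_mul_le_of_radial (ε := ENNReal.ofReal ε) (g := fun y => ENNReal.ofReal (g y))
    hK hK0 hmono hg.aestronglyMeasurable.aemeasurable.ennreal_ofReal (fun ρ hρ => by
      rw [← ofReal_integral_eq_lintegral_ofReal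
        (hg.mono_set (closedBall_subset_closedBall hρ.2)) (Eventually.of_forall hg0),
        Real.volume_closedBall, ← ENNReal.ofReal_mul hε]
      exact ENNReal.ofReal_le_ofReal (hmean ρ hρ))
  have hKg : IntegrableOn (fun y => K y * g y) (closedBall θ δ) :=
    hg.continuousOn_mul hK.continuousOn (isCompact_closedBall θ δ)
  simp only [← ENNReal.ofReal_mul (hK0 _)] at h1
  rw [← ofReal_integral_eq_lintegral_ofReal hKi (Eventually.of_forall hK0),
    ← ofReal_integral_eq_lintegral_ofReal hKg
      (Eventually.of_forall fun y => mul_nonneg (hK0 y) (hg0 y)), ← ENNReal.ofReal_mul hε] at h1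
  exact (ENNReal.ofReal_le_ofReal_iff (mul_nonneg hε (integral_nonneg hK0))).1 h1

end RadialKernel

section Fatou

variable {F : Type*} [NormedAddCommGroup F] [NormedSpace ℝ F]

theorem periodic_comp_circleExp {X : Type*} (h : Circle → X) :
    Function.Periodic (fun θ : ℝ => h (Circle.exp θ)) (2 * Real.pi) := fun θ => by
  simp

theorem intervalIntegrable_comp_circleExp {F : Type*} [NormedAddCommGroup F] {h : Circle → F}
    (hh : Integrable h circleProb) (a b : ℝ) :
    IntervalIntegrable (fun θ => h (Circle.exp θ)) volume a b := by
  refine (periodic_comp_circleExp h).intervalIntegrable two_pi_pos_real.ne' (t := 0) ?_ a b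
  rw [zero_add]
  exact (integrable_circleProb hh.1).1 hh

theorem integral_circleProb_eq_integral_centered {h : Circle → F}
    (hh : AEStronglyMeasurable h circleProb) (θ : ℝ) :
    ∫ s, h s ∂circleProb =
      (2 * Real.pi)⁻¹ • ∫ y in closedBall θ Real.pi, h (Circle.exp y) := by
  rw [integral_circleProb hh, Real.closedBall_eq_Icc, integral_Icc_eq_integral_Ioc,
    ← intervalIntegral.integral_of_le (by linarith [Real.pi_pos])]
  have := (periodic_comp_circleExp h).intervalIntegral_add_eq 0 (θ - Real.pi)
  rw [zero_add] at this
  rw [this]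
  congr 2
  ring

theorem poissonKernel_polar {r : ℝ} (θ y : ℝ) :
    poissonKernel 0 ((r : ℂ) * Circle.exp θ) (Circle.exp y) =
      (1 - r ^ 2) / (1 + r ^ 2 - 2 * r * Real.cos (y - θ)) := by
  rw [poissonKernel_zero_apply, norm_mul, norm_circle, mul_one, Complex.norm_real, Real.norm_eq_abs,
    sq_abs, ← Complex.normSq_eq_norm_sq]
  congr 1
  rw [Complex.normSq_apply]
  simp only [Circle.coe_exp, Complex.exp_ofReal_mul_I_re, Complex.exp_ofReal_mul_I_im,
    Complex.sub_re, Complex.sub_im, Complex.re_ofReal_mul, Complex.im_ofReal_mul, Real.cos_sub]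
  nlinarith [Real.sin_sq_add_cos_sq θ, Real.sin_sq_add_cos_sq y]

theorem real_mul_circle_mem_ball {r : ℝ} (hr : r ∈ Ioo (0 : ℝ) 1) (s : Circle) :
    (r : ℂ) * s ∈ ball (0 : ℂ) 1 := by
  simp [norm_circle, abs_of_pos hr.1, hr.2]

theorem cos_sub_le_of_dist_le {θ x y : ℝ} (hxy : dist x θ ≤ dist y θ) (hy : dist y θ ≤ Real.pi) :
    Real.cos (y - θ) ≤ Real.cos (x - θ) := by
  rw [← Real.cos_abs (y - θ), ← Real.cos_abs (x - θ)]
  exact Real.cos_le_cos_of_nonneg_of_le_pi (abs_nonneg _) hy hxy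

theorem ae_lebesgue_point {F : Type*} [NormedAddCommGroup F] {h : Circle → F} (hh : Integrable h circleProb) :
    ∀ᵐ θ : ℝ, ∀ ε > 0, ∃ δ ∈ Ioc 0 Real.pi, ∀ ρ ∈ Ioc 0 δ,
      ∫ y in closedBall θ ρ, ‖h (Circle.exp y) - h (Circle.exp θ)‖ ≤ ε * (2 * ρ) := by
  have hloc : LocallyIntegrable (fun θ : ℝ => h (Circle.exp θ)) := fun x =>
    ⟨Ioc (x - 1) (x + 1), Ioc_mem_nhds (by linarith) (by linarith),
      (intervalIntegrable_iff_integrableOn_Ioc_of_le (by linarith)).1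
        (intervalIntegrable_comp_circleExp hh _ _)⟩
  filter_upwards [IsUnifLocDoublingMeasure.ae_tendsto_average_norm_sub volume hloc 1] with θ hθ ε hε
  have h1 := hθ (l := 𝓝[>] (0 : ℝ)) (fun _ => θ) id tendsto_id (by
    filter_upwards [self_mem_nhdsWithin] with ρ hρ
    simpa using (show (0 : ℝ) < ρ from hρ).le)
  have h2 := (h1.eventually (gt_mem_nhds hε))
  rw [eventually_nhdsWithin_iff, Metric.eventually_nhds_iff] at h2
  obtain ⟨δ, hδ, h3⟩ := h2
  refine ⟨min (δ / 2) Real.pi, ⟨lt_min (by linarith) Real.pi_pos, min_le_right _ _⟩, fun ρ hρ => ?_⟩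
  have h4 : ρ ≤ δ / 2 := hρ.2.trans (min_le_left _ _)
  have h5 := h3 (y := ρ) (by rw [Real.dist_0_eq_abs, abs_of_pos hρ.1]; linarith) hρ.1
  simp only [id] at h5
  rw [setAverage_eq, measureReal_def, Real.volume_closedBall,
    ENNReal.toReal_ofReal (by linarith [hρ.1]), smul_eq_mul, inv_mul_lt_iff₀ (by linarith [hρ.1])]
    at h5
  linarith

theorem tendsto_poisson_of_lebesgue_point [CompleteSpace F] {h : Circle → F}
    (hh : Integrable h circleProb) {θ : ℝ}
    (hθ : ∀ ε > 0, ∃ δ ∈ Ioc 0 Real.pi, ∀ ρ ∈ Ioc 0 δ,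
      ∫ y in closedBall θ ρ, ‖h (Circle.exp y) - h (Circle.exp θ)‖ ≤ ε * (2 * ρ)) :
    Tendsto (fun r : ℝ => poisson h ((r : ℂ) * Circle.exp θ)) (𝓝[<] 1) (𝓝 (h (Circle.exp θ))) := by
  rw [tendsto_iff_norm_sub_tendsto_zero]
  set g : ℝ → ℝ := fun y => ‖h (Circle.exp y) - h (Circle.exp θ)‖ with hg
  have hgi : IntegrableOn g (closedBall θ Real.pi) := by
    rw [Real.closedBall_eq_Icc, integrableOn_Icc_iff_integrableOn_Ioc]
    refine (intervalIntegrable_iff_integrableOn_Ioc_of_le (by linarith [Real.pi_pos])).1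
      (IntervalIntegrable.norm ?_)
    exact (intervalIntegrable_comp_circleExp hh _ _).sub intervalIntegrable_const
  have hg0 : ∀ y, 0 ≤ g y := fun y => norm_nonneg _
  set I := ∫ y in closedBall θ Real.pi, g y with hI
  have hI0 : 0 ≤ I := integral_nonneg hg0
  refine Metric.tendsto_nhds.2 fun η hη => ?_
  obtain ⟨δ, hδ, hδ2⟩ := hθ (η / 2) (by linarith)
  set c := 1 - Real.cos δ with hc
  have hc0 : 0 < c := by
    have := Real.cos_lt_cos_of_nonneg_of_le_pi le_rfl hδ.2 hδ.1
    rw [Real.cos_zero] at this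
    linarith
  have hfar : Tendsto (fun r : ℝ => (2 * Real.pi)⁻¹ * ((1 - r ^ 2) / c * I)) (𝓝[<] 1) (𝓝 0) := by
    have : Continuous (fun r : ℝ => (2 * Real.pi)⁻¹ * ((1 - r ^ 2) / c * I)) := by fun_prop
    have := this.tendsto 1
    simp only [one_pow, sub_self, zero_div, zero_mul, mul_zero] at this
    exact this.mono_left nhdsWithin_le_nhds
  filter_upwards [hfar.eventually (gt_mem_nhds (show 0 < η / 2 by linarith)),
    Ioo_mem_nhdsLT (show (1 / 2 : ℝ) < 1 by norm_num)] with r hr1 hr2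
  have hr : r ∈ Ioo (0 : ℝ) 1 := ⟨by linarith [hr2.1], hr2.2⟩
  have ht := real_mul_circle_mem_ball hr (Circle.exp θ)
  set K : ℝ → ℝ := fun y => poissonKernel 0 ((r : ℂ) * Circle.exp θ) (Circle.exp y) with hKdef
  have hK : Continuous K := (continuous_poissonKernel ht).comp Circle.exp.continuous
  have hK0 : ∀ y, 0 ≤ K y := fun y => (poissonKernel_pos ht _).le
  have hnum : 0 ≤ 1 - r ^ 2 := by nlinarith [hr.1, hr.2]
  have hden : ∀ y, 0 < 1 + r ^ 2 - 2 * r * Real.cos y := fun y => by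
    nlinarith [Real.cos_le_one y, hr.1, hr.2, mul_le_mul_of_nonneg_left (Real.cos_le_one y) hr.1.le]
  have hnear : ∫ y in closedBall θ δ, K y * g y ≤ η / 2 * ∫ y in closedBall θ δ, K y := by
    refine integral_mul_le_of_radial (by linarith) hK hK0 hg0 (fun x _ y hy hxy => ?_)
      (hgi.mono_set (closedBall_subset_closedBall hδ.2)) hδ2
    simp only [hKdef, poissonKernel_polar]
    have := cos_sub_le_of_dist_le hxy (le_trans hy hδ.2)
    refine div_le_div_of_nonneg_left hnum (hden _) ?_
    nlinarith [hr.1]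
  have hKi : IntegrableOn K (closedBall θ Real.pi) :=
    hK.continuousOn.integrableOn_compact (isCompact_closedBall _ _)
  have hK1 : ∫ y in closedBall θ δ, K y ≤ 2 * Real.pi := by
    have h1 := integral_circleProb_eq_integral_centered
      (continuous_poissonKernel ht).aestronglyMeasurable θ
    rw [integral_poissonKernel ht, smul_eq_mul, eq_comm, inv_mul_eq_iff_eq_mul₀ two_pi_pos_real.ne',
      mul_one] at h1
    rw [← h1]
    exact setIntegral_mono_set hKi (Eventually.of_forall hK0)
      (closedBall_subset_closedBall hδ.2).eventuallyLE
  have hKgi : IntegrableOn (fun y => K y * g y) (closedBall θ Real.pi) :=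
    hgi.continuousOn_mul hK.continuousOn (isCompact_closedBall _ _)
  have hsplit : ∫ y in closedBall θ Real.pi, K y * g y ≤
      (∫ y in closedBall θ δ, K y * g y) + (1 - r ^ 2) / c * I := by
    have hind : ∫ y in closedBall θ δ, K y * g y =
        ∫ y in closedBall θ Real.pi, (closedBall θ δ).indicator (fun y => K y * g y) y := by
      rw [setIntegral_indicator measurableSet_closedBall,
        inter_eq_self_of_subset_right (closedBall_subset_closedBall hδ.2)]
    rw [hind, hI, ← integral_const_mul, ← integral_add
      (hKgi.indicator measurableSet_closedBall) (hgi.const_mul _)]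
    refine setIntegral_mono_on hKgi
      ((hKgi.indicator measurableSet_closedBall).add (hgi.const_mul _))
      measurableSet_closedBall fun y hy => ?_
    by_cases hyδ : y ∈ closedBall θ δ
    · rw [indicator_of_mem hyδ]
      have : 0 ≤ (1 - r ^ 2) / c * g y := mul_nonneg (div_nonneg hnum hc0.le) (hg0 y)
      linarith
    · rw [indicator_of_notMem hyδ, zero_add]
      refine mul_le_mul_of_nonneg_right ?_ (hg0 y)
      simp only [hKdef, poissonKernel_polar]
      refine div_le_div_of_nonneg_left hnum hc0 ?_
      have hd : dist (θ + δ) θ ≤ dist y θ := by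
        rw [mem_closedBall, not_le] at hyδ
        rw [Real.dist_eq, add_sub_cancel_left, abs_of_pos hδ.1]
        exact hyδ.le
      have := cos_sub_le_of_dist_le hd hy
      rw [add_sub_cancel_left] at this
      nlinarith [hr2.1, Real.cos_le_one δ, sq_nonneg (1 - r)]
  have hnorm : ‖poisson h ((r : ℂ) * Circle.exp θ) - h (Circle.exp θ)‖ ≤
      (2 * Real.pi)⁻¹ * ∫ y in closedBall θ Real.pi, K y * g y := by
    nth_rw 1 [← poisson_const ht (h (Circle.exp θ))]
    rw [← poisson_sub ht hh (integrable_const _)]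
    refine (norm_integral_le_integral_norm _).trans (le_of_eq ?_)
    have hi := (integrable_poissonKernel_smul ht (hh.sub (integrable_const (h (Circle.exp θ))))).norm
    refine (integral_circleProb_eq_integral_centered hi.1 θ).trans ?_
    rw [smul_eq_mul]
    congr 1
    refine integral_congr_ae (Eventually.of_forall fun y => ?_)
    simp only [norm_smul, Real.norm_of_nonneg (poissonKernel_pos ht _).le]
    rfl
  rw [Real.dist_0_eq_abs, abs_norm]
  have h2 : (2 * Real.pi)⁻¹ * (η / 2 * (2 * Real.pi)) = η / 2 := by
    field_simp
  have h3 : (2 * Real.pi)⁻¹ * ∫ y in closedBall θ Real.pi, K y * g y ≤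
      (2 * Real.pi)⁻¹ * (η / 2 * (2 * Real.pi) + (1 - r ^ 2) / c * I) := by
    refine mul_le_mul_of_nonneg_left ?_ (inv_pos.2 two_pi_pos_real).le
    have := mul_le_mul_of_nonneg_left hK1 (show 0 ≤ η / 2 by linarith)
    linarith
  rw [mul_add, h2] at h3
  linarith

/-- **Fatou's theorem**: the Poisson extension of an integrable function has it as radial limit
almost everywhere. -/
theorem ae_tendsto_poisson [CompleteSpace F] {h : Circle → F} (hh : Integrable h circleProb) :
    ∀ᵐ s : Circle ∂circleProb,
      Tendsto (fun r : ℝ => poisson h ((r : ℂ) * (s : ℂ))) (𝓝[<] 1) (𝓝 (h s)) := by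
  refine ae_circleProb ?_
  filter_upwards [ae_lebesgue_point hh] with θ hθ
  exact tendsto_poisson_of_lebesgue_point hh hθ

end Fatou

section LinearFunctions

variable {n : ℕ} {p : ℝ} {t : ℂ}

theorem continuous_dot : Continuous (fun x : Cn n × Cn n => dot x.1 x.2) := by
  unfold dot; fun_prop

theorem tendsto_dot {ι : Type*} {l : Filter ι} {a b : ι → Cn n} {x y : Cn n}
    (ha : Tendsto a l (𝓝 x)) (hb : Tendsto b l (𝓝 y)) :
    Tendsto (fun i => dot (a i) (b i)) l (𝓝 (dot x y)) := by
  refine tendsto_finsetSum _ fun j _ => Tendsto.mul ?_ ?_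
  · exact ((PiLp.continuous_apply 2 _ j).tendsto x).comp ha
  · exact ((PiLp.continuous_apply 2 _ j).tendsto y).comp hb

/-- The real-linear form `z ↦ Re (z · w)`. -/
noncomputable def reDot (w : Cn n) : Cn n →L[ℝ] ℝ where
  toFun z := (dot z w).re
  map_add' x y := by simp [dot, add_mul, Finset.sum_add_distrib]
  map_smul' c x := by
    simp only [dot, PiLp.smul_apply, smul_mul_assoc, ← Finset.smul_sum, Complex.smul_re]
    rfl
  cont := Complex.continuous_re.comp
    (continuous_dot.comp (continuous_id.prodMk continuous_const))

@[simp] theorem reDot_apply (w z : Cn n) : reDot w z = (dot z w).re := rfl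

theorem dot_comm (z w : Cn n) : dot z w = dot w z := by simp [dot, mul_comm]

theorem norm_dot_le (z w : Cn n) : ‖dot z w‖ ≤ ‖z‖ * ‖w‖ := by
  have h := norm_inner_le_norm (𝕜 := ℂ) (WithLp.toLp 2 fun j => (starRingEnd ℂ) (z j) : Cn n) w
  have h1 : ‖(WithLp.toLp 2 fun j => (starRingEnd ℂ) (z j) : Cn n)‖ = ‖z‖ := by
    simp [EuclideanSpace.norm_eq]
  rw [h1] at h
  simpa [PiLp.inner_apply, dot, mul_comm (w _)] using h

theorem integrable_re_dot {f : Circle → Cn n} (hf : Integrable f circleProb) (w : Cn n) :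
    Integrable (fun s => (dot (f s) w).re) circleProb := (reDot w).integrable_comp hf

theorem integrable_re {f₀ : Circle → ℂ} (hf₀ : Integrable f₀ circleProb) :
    Integrable (fun s => (f₀ s).re) circleProb := hf₀.re

theorem linFun_eq_poisson {f₀ : Circle → ℂ} {f : Circle → Cn n} (hf₀ : Integrable f₀ circleProb)
    (hf : Integrable f circleProb) (ht : t ∈ ball (0 : ℂ) 1) (w : Cn n) :
    linFun f₀ f t w = poisson (fun s => (dot (f s) w).re - (f₀ s).re) t := by
  rw [poisson_sub ht (integrable_re_dot hf w) (integrable_re hf₀)]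
  have := poisson_clm ht (reDot w) hf
  simp only [reDot_apply] at this
  rw [this]
  rfl

theorem boundaryLE_linFun_iff {φ : Circle → Cn n → ℝ} {f₀ : Circle → ℂ} {f : Circle → Cn n}
    (hf₀ : Integrable f₀ circleProb) (hf : Integrable f circleProb) :
    BoundaryLE (linFun f₀ f) φ ↔
      ∀ᵐ s ∂circleProb, ∀ z : Cn n, (dot (f s) z).re - (f₀ s).re ≤ φ s z := by
  have key : ∀ᵐ s : Circle ∂circleProb, ∀ z : Cn n,
      limsup (fun x : ℝ × Cn n => (linFun f₀ f ((x.1 : ℂ) * (s : ℂ)) x.2 : EReal))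
        (𝓝[<] (1 : ℝ) ×ˢ 𝓝 z) = (((dot (f s) z).re - (f₀ s).re : ℝ) : EReal) := by
    filter_upwards [ae_tendsto_poisson hf, ae_tendsto_poisson (integrable_re hf₀)] with s h1 h2 z
    have h3 : Tendsto (fun x : ℝ × Cn n => dot (poisson f ((x.1 : ℂ) * (s : ℂ))) x.2)
        (𝓝[<] (1 : ℝ) ×ˢ 𝓝 z) (𝓝 (dot (f s) z)) :=
      tendsto_dot (h1.comp tendsto_fst) tendsto_snd
    have h4 : Tendsto (fun x : ℝ × Cn n => linFun f₀ f ((x.1 : ℂ) * (s : ℂ)) x.2)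
        (𝓝[<] (1 : ℝ) ×ˢ 𝓝 z) (𝓝 ((dot (f s) z).re - (f₀ s).re)) := by
      have h5 := (Complex.continuous_re.tendsto _).comp h3
      have h6 := h2.comp (tendsto_fst (f := 𝓝[<] (1 : ℝ)) (g := 𝓝 z))
      simp only [linFun]
      exact h5.sub h6
    exact ((continuous_coe_real_ereal.tendsto _).comp h4).limsup_eq
  refine eventually_congr (key.mono fun s hs => forall_congr' fun z => ?_)
  rw [hs z, EReal.coe_le_coe_iff]

theorem isPSH_re {X : Type*} [NormedAddCommGroup X] [NormedSpace ℂ X] {Ω : Set X} {u : X → ℝ}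
    {H : X → ℂ} (hΩ : IsOpen Ω) (hH : DifferentiableOn ℂ H Ω) (hu : ∀ x ∈ Ω, u x = (H x).re) :
    IsPSH Ω u := by
  refine ⟨?_, fun g hg hmaps => ?_⟩
  · have : ContinuousOn u Ω :=
      (Complex.continuous_re.comp_continuousOn hH.continuousOn).congr hu
    exact this.upperSemicontinuousOn
  · have hd : DifferentiableOn ℂ (H ∘ g) (closedBall 0 1) := fun x hx =>
      ((hH.differentiableAt (hΩ.mem_nhds (hmaps hx))).comp x
        (hg x hx).differentiableAt).differentiableWithinAt
    have hdc : DiffContOnCl ℂ (H ∘ g) (ball 0 |1|) := by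
      rw [abs_one]
      exact ⟨hd.mono ball_subset_closedBall, hd.continuousOn.mono closure_ball_subset_closedBall⟩
    have hci : CircleIntegrable (H ∘ g) 0 1 :=
      ContinuousOn.circleIntegrable zero_le_one (hd.continuousOn.mono sphere_subset_closedBall)
    have heq : ∀ τ ∈ closedBall (0 : ℂ) 1, u (g τ) = (H (g τ)).re := fun τ hτ => hu _ (hmaps hτ)
    have hsph : EqOn (fun τ => u (g τ)) (Complex.reCLM ∘ (H ∘ g)) (sphere 0 |1|) := fun τ hτ => by
      rw [abs_one] at hτ
      exact heq τ (sphere_subset_closedBall hτ)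
    constructor
    · refine ContinuousOn.circleIntegrable zero_le_one ?_
      rw [← abs_one (α := ℝ)]
      refine ContinuousOn.congr ?_ hsph
      rw [abs_one]
      exact Complex.continuous_re.comp_continuousOn
        (hd.continuousOn.mono sphere_subset_closedBall)
    · rw [Real.circleAverage_congr_sphere hsph, Complex.reCLM.circleAverage_comp_comm hci,
        hdc.circleAverage, heq 0 (by simp)]
      rfl

theorem isPSH_linFun {f₀ : Circle → ℂ} {f : Circle → Cn n} (hf₀ : Integrable f₀ circleProb)
    (hf : DifferentiableOn ℂ (poisson f) (ball 0 1)) :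
    IsPSH (ball (0 : ℂ) 1 ×ˢ (univ : Set (Cn n)))
      (fun y : ℂ × Cn n => linFun f₀ f y.1 y.2) := by
  obtain ⟨H, hH, hH2⟩ := exists_differentiableOn_re_eq_poisson (integrable_re hf₀)
  have hm : MapsTo (Prod.fst : ℂ × Cn n → ℂ) (ball (0 : ℂ) 1 ×ˢ (univ : Set (Cn n))) (ball 0 1) :=
    fun y hy => hy.1
  refine isPSH_re (H := fun y => dot (poisson f y.1) y.2 - H y.1)
    (isOpen_ball.prod isOpen_univ) ?_ fun y hy => ?_
  · refine DifferentiableOn.sub ?_ (hH.comp differentiableOn_fst hm)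
    have hf' : DifferentiableOn ℂ (fun y : ℂ × Cn n => poisson f y.1)
      (ball (0 : ℂ) 1 ×ˢ (univ : Set (Cn n))) := hf.comp differentiableOn_fst hm
    unfold dot
    refine DifferentiableOn.fun_sum fun j _ => DifferentiableOn.mul ?_ ?_
    · exact (differentiableOn_piLp 2).1 hf' j
    · exact (differentiableOn_piLp 2).1 differentiableOn_snd j
  · rw [linFun, Complex.sub_re, ← hH2 y.1 hy.1]

theorem linearEnvelope_le_perronEnvelope (hp : 1 < p) (φ : Circle → Cn n → ℝ)
    (w : Cn n) : linearEnvelope p φ t w ≤ perronEnvelope φ t w := by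
  have hq : 1 < p / (p - 1) := by
    rw [lt_div_iff₀ (by linarith)]; linarith
  refine sSup_le ?_
  rintro x ⟨f₀, f, hf₀, hf, hle, rfl⟩
  have hfi := hf.integrable hq
  refine le_sSup ⟨linFun f₀ f, isPSH_linFun hf₀ hf.2, fun t' ht' w' => ?_, hle, rfl⟩
  have hae := (boundaryLE_linFun_iff hf₀ hfi).1 hle
  induction hS : (⨆ s : Circle, (φ s w' : EReal)) with
  | bot =>
    have := le_iSup (fun s : Circle => (φ s w' : EReal)) 1
    rw [hS, le_bot_iff] at this
    exact absurd this (EReal.coe_ne_bot _)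
  | top => exact le_top
  | coe M =>
    rw [EReal.coe_le_coe_iff, linFun_eq_poisson hf₀ hfi ht', ← poisson_const ht' M]
    refine poisson_mono ht' ((integrable_re_dot hfi w').sub (integrable_re hf₀)) (integrable_const _) ?_
    filter_upwards [hae] with s hs
    refine (hs w').trans ?_
    have := le_iSup (fun s : Circle => (φ s w' : EReal)) s
    rw [hS] at this
    exact EReal.coe_le_coe_iff.1 this

end LinearFunctions

section PoissonMeasure

variable {F : Type*} [NormedAddCommGroup F] [NormedSpace ℝ F] {t : ℂ}

/-- The harmonic measure of the disc at the point `t`. -/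
noncomputable def poissonMeasure (t : ℂ) : Measure Circle :=
  circleProb.withDensity fun s => ENNReal.ofReal (poissonKernel 0 t s)

theorem measurable_poissonKernel (t : ℂ) : Measurable (fun s : Circle => poissonKernel 0 t s) := by
  have h : Continuous (fun s : Circle => ‖(s : ℂ) - t‖ ^ 2) := by fun_prop
  simp only [poissonKernel_zero_apply]
  exact measurable_const.div h.measurable

theorem integral_poissonMeasure (ht : t ∈ ball (0 : ℂ) 1) (h : Circle → F) :
    ∫ s, h s ∂poissonMeasure t = poisson h t := by
  rw [poissonMeasure, integral_withDensity_eq_integral_toReal_smul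
    (measurable_poissonKernel t).ennreal_ofReal (Eventually.of_forall fun _ => ENNReal.ofReal_lt_top)]
  simp only [ENNReal.toReal_ofReal (poissonKernel_pos ht _).le]
  rfl

theorem integrable_poissonMeasure (ht : t ∈ ball (0 : ℂ) 1) {h : Circle → F} :
    Integrable h (poissonMeasure t) ↔
      Integrable (fun s : Circle => poissonKernel 0 t s • h s) circleProb := by
  rw [poissonMeasure, integrable_withDensity_iff_integrable_smul'
    (measurable_poissonKernel t).ennreal_ofReal (Eventually.of_forall fun _ => ENNReal.ofReal_lt_top)]
  simp only [ENNReal.toReal_ofReal (poissonKernel_pos ht _).le]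

theorem isProbabilityMeasure_poissonMeasure (ht : t ∈ ball (0 : ℂ) 1) :
    IsProbabilityMeasure (poissonMeasure t) := by
  constructor
  rw [poissonMeasure, withDensity_apply _ MeasurableSet.univ, Measure.restrict_univ,
    ← ofReal_integral_eq_lintegral_ofReal (integrable_poissonKernel ht)
      (Eventually.of_forall fun s => (poissonKernel_pos ht s).le), integral_poissonKernel ht,
    ENNReal.ofReal_one]

/-- Jensen's inequality for the Poisson extension. -/
theorem norm_poisson_rpow_le [CompleteSpace F] {p : ℝ} (hp : 1 ≤ p) (ht : t ∈ ball (0 : ℂ) 1)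
    {f : Circle → F} (hf : Integrable f circleProb)
    (hfp : Integrable (fun s => ‖f s‖ ^ p) circleProb) :
    ‖poisson f t‖ ^ p ≤ poisson (fun s => ‖f s‖ ^ p) t := by
  have := isProbabilityMeasure_poissonMeasure ht
  have h1 := (convexOn_rpow hp).map_integral_le (μ := poissonMeasure t) (f := fun s => ‖f s‖)
    (Real.continuous_rpow_const (by linarith)).continuousOn isClosed_Ici
    (Eventually.of_forall fun s => norm_nonneg _)
    ((integrable_poissonMeasure ht).2 (integrable_poissonKernel_smul ht hf.norm))
    ((integrable_poissonMeasure ht).2 (integrable_poissonKernel_smul ht hfp))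
  rw [← integral_poissonMeasure ht, ← integral_poissonMeasure ht]
  exact (Real.rpow_le_rpow (norm_nonneg _) (norm_integral_le_integral_norm _) (by linarith)).trans h1

/-- The semigroup property of the Poisson kernel. -/
theorem poisson_poisson {r : ℝ} (hr : r ∈ Ioo 0 1) (htr : ‖t‖ < r) {h : Circle → ℝ}
    (hh : Integrable h circleProb) :
    poisson (fun s : Circle => poisson h ((r : ℂ) * s)) (t / r) = poisson h t := by
  obtain ⟨H, hH, hH2⟩ := exists_differentiableOn_re_eq_poisson hh
  have hr0 : (r : ℂ) ≠ 0 := by exact_mod_cast hr.1.ne'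
  have htr' : t / r ∈ ball (0 : ℂ) 1 := by
    rw [mem_ball_zero_iff, norm_div, Complex.norm_real, Real.norm_of_nonneg hr.1.le,
      div_lt_one hr.1]
    exact htr
  have hmaps : MapsTo (fun z : ℂ => (r : ℂ) * z) (closedBall 0 1) (ball 0 1) := fun z hz => by
    rw [mem_ball_zero_iff, norm_mul, Complex.norm_real, Real.norm_of_nonneg hr.1.le]
    rw [mem_closedBall_zero_iff] at hz
    nlinarith [hr.1, hr.2]
  have hd : DifferentiableOn ℂ (fun z => H ((r : ℂ) * z)) (closedBall 0 1) :=
    hH.comp (by fun_prop) hmaps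
  have hdc : DiffContOnCl ℂ (fun z => H ((r : ℂ) * z)) (ball 0 1) :=
    ⟨hd.mono ball_subset_closedBall, hd.continuousOn.mono closure_ball_subset_closedBall⟩
  have hc : Continuous (fun s : Circle => H ((r : ℂ) * s)) :=
    hd.continuousOn.comp_continuous continuous_coe_circle fun s => by simp [norm_circle]
  have hi : Integrable (fun s : Circle => H ((r : ℂ) * s)) circleProb := by
    simpa using integrable_continuous_smul hc (integrable_const (1 : ℂ))
  have h1 := poisson_of_diffContOnCl hdc htr'
  have h2 := poisson_clm htr' Complex.reCLM hi
  rw [h1] at h2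
  simp only [Complex.reCLM_apply] at h2
  rw [mul_div_cancel₀ _ hr0, ← hH2 t (by simpa using htr.trans hr.2)] at h2
  rw [← h2]
  congr 1
  ext s
  exact hH2 _ (hmaps (by simp [norm_circle]))

end PoissonMeasure

section Mobius

/-- The integral of continuous functions on the additive circle, transported to a measure on the
unit circle. -/
noncomputable def circleIntegralCLM (μ : Measure Circle) [IsFiniteMeasure μ] :
    C(AddCircle (1 : ℝ), ℂ) →L[ℂ] ℂ :=
  LinearMap.mkContinuous
    { toFun := fun g => ∫ s, g ((AddCircle.homeomorphCircle one_ne_zero).symm s) ∂μ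
      map_add' := fun g h => by
        refine integral_add ?_ ?_ <;>
        exact ((map_continuous _).comp (Homeomorph.continuous _)).integrable_of_hasCompactSupport
          (HasCompactSupport.of_compactSpace _)
      map_smul' := fun c g => integral_smul c _ }
    (μ.real univ) fun g => by
      rw [mul_comm]
      exact norm_integral_le_of_norm_le_const (Eventually.of_forall fun s => g.norm_coe_le_norm _)

/-- A finite measure on the circle is determined by its Fourier coefficients. -/
theorem measure_circle_ext {μ ν : Measure Circle} [IsFiniteMeasure μ] [IsFiniteMeasure ν]
    (h : ∀ k : ℤ, ∫ s : Circle, (s : ℂ) ^ k ∂μ = ∫ s : Circle, (s : ℂ) ^ k ∂ν) : μ = ν := by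
  have key : circleIntegralCLM μ = circleIntegralCLM ν := by
    refine ContinuousLinearMap.ext_on (s := range (fourier (T := (1 : ℝ)))) ?_ ?_
    · rw [← Submodule.dense_iff_topologicalClosure_eq_top.symm.eq]
      exact span_fourier_closure_eq_top
    · rintro _ ⟨k, rfl⟩
      have h1 : ∀ s : Circle, fourier k ((AddCircle.homeomorphCircle
          (one_ne_zero : (1 : ℝ) ≠ 0)).symm s) = (s : ℂ) ^ k := fun s => by
        obtain ⟨x, rfl⟩ := (AddCircle.homeomorphCircle (one_ne_zero : (1 : ℝ) ≠ 0)).surjective s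
        rw [Homeomorph.symm_apply_apply, fourier_apply, AddCircle.toCircle_zsmul,
          AddCircle.homeomorphCircle_apply, Circle.coe_zpow]
      change ∫ s, fourier k ((AddCircle.homeomorphCircle one_ne_zero).symm s) ∂μ =
        ∫ s, fourier k ((AddCircle.homeomorphCircle one_ne_zero).symm s) ∂ν
      simp only [h1]
      exact h k
  refine ext_of_forall_integral_eq_of_IsFiniteMeasure fun f => ?_
  have h2 := congrArg (fun L => L (⟨fun x => ((f (AddCircle.homeomorphCircle
    (one_ne_zero : (1 : ℝ) ≠ 0) x) : ℝ) : ℂ), by fun_prop⟩ : C(AddCircle (1 : ℝ), ℂ))) key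
  change ∫ s, ((f (AddCircle.homeomorphCircle one_ne_zero
    ((AddCircle.homeomorphCircle one_ne_zero).symm s)) : ℝ) : ℂ) ∂μ =
    ∫ s, ((f (AddCircle.homeomorphCircle one_ne_zero
    ((AddCircle.homeomorphCircle one_ne_zero).symm s)) : ℝ) : ℂ) ∂ν at h2
  simp only [Homeomorph.apply_symm_apply, integral_complex_ofReal] at h2
  exact_mod_cast h2

/-- The automorphism of the disc that sends `0` to `a`. -/
noncomputable def mobius (a τ : ℂ) : ℂ := (τ + a) / (1 + (starRingEnd ℂ) a * τ)

variable {a : ℂ}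

theorem mobius_zero (a : ℂ) : mobius a 0 = a := by simp [mobius]

theorem mobius_denom_ne_zero (ha : a ∈ ball (0 : ℂ) 1) {τ : ℂ} (hτ : τ ∈ closedBall (0 : ℂ) 1) :
    1 + (starRingEnd ℂ) a * τ ≠ 0 := by
  intro h
  have h1 : ‖(starRingEnd ℂ) a * τ‖ < 1 := by
    rw [norm_mul, RCLike.norm_conj]
    rw [mem_ball_zero_iff] at ha
    rw [mem_closedBall_zero_iff] at hτ
    nlinarith [norm_nonneg a, norm_nonneg τ]
  rw [eq_neg_of_add_eq_zero_right h, norm_neg, norm_one] at h1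
  exact lt_irrefl _ h1

theorem analyticOnNhd_mobius (ha : a ∈ ball (0 : ℂ) 1) :
    AnalyticOnNhd ℂ (mobius a) (closedBall 0 1) := fun τ hτ => by
  unfold mobius
  exact AnalyticAt.div (by fun_prop) (by fun_prop) (mobius_denom_ne_zero ha hτ)

theorem norm_mobius_circle (ha : a ∈ ball (0 : ℂ) 1) (τ : Circle) : ‖mobius a τ‖ = 1 := by
  have h0 := mobius_denom_ne_zero ha (τ := τ) (by simp [norm_circle])
  have h1 : (1 : ℂ) + (starRingEnd ℂ) a * τ = (starRingEnd ℂ) ((τ : ℂ) + a) * τ := by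
    have h2 : (starRingEnd ℂ) (τ : ℂ) * τ = 1 := by
      rw [mul_comm, Complex.mul_conj, Complex.normSq_eq_norm_sq, norm_circle]; simp
    rw [map_add, add_mul, h2]
  have h3 : ‖(1 : ℂ) + (starRingEnd ℂ) a * τ‖ = ‖(τ : ℂ) + a‖ := by
    rw [h1, norm_mul, norm_circle, mul_one, RCLike.norm_conj]
  rw [mobius, norm_div, h3, div_self]
  rw [← h3]
  exact norm_ne_zero_iff.2 h0

theorem norm_mobius_le (ha : a ∈ ball (0 : ℂ) 1) {τ : ℂ} (hτ : τ ∈ closedBall (0 : ℂ) 1) :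
    ‖mobius a τ‖ ≤ 1 := by
  have h0 := mobius_denom_ne_zero ha hτ
  rw [mobius, norm_div, div_le_one (norm_pos_iff.2 h0)]
  rw [mem_ball_zero_iff] at ha
  rw [mem_closedBall_zero_iff] at hτ
  refine le_of_sq_le_sq ?_ (norm_nonneg _)
  rw [← Complex.normSq_eq_norm_sq, ← Complex.normSq_eq_norm_sq]
  have h1 : Complex.normSq (1 + (starRingEnd ℂ) a * τ) - Complex.normSq (τ + a) =
      (1 - Complex.normSq a) * (1 - Complex.normSq τ) := by
    simp only [Complex.normSq_apply, Complex.add_re, Complex.add_im, Complex.mul_re, Complex.mul_im,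
      Complex.conj_re, Complex.conj_im, Complex.one_re, Complex.one_im]
    ring
  have h2 : Complex.normSq a ≤ 1 := by
    rw [Complex.normSq_eq_norm_sq]; nlinarith [norm_nonneg a]
  have h3 : Complex.normSq τ ≤ 1 := by
    rw [Complex.normSq_eq_norm_sq]; nlinarith [norm_nonneg τ]
  nlinarith

/-- The boundary values of `mobius a`. -/
noncomputable def circleMobius (ha : a ∈ ball (0 : ℂ) 1) (τ : Circle) : Circle :=
  (⟨mobius a τ, mem_sphere_zero_iff_norm.2 (norm_mobius_circle ha τ)⟩ : Submonoid.unitSphere ℂ)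

theorem coe_circleMobius (ha : a ∈ ball (0 : ℂ) 1) (τ : Circle) :
    (circleMobius ha τ : ℂ) = mobius a τ := rfl

theorem continuous_circleMobius (ha : a ∈ ball (0 : ℂ) 1) : Continuous (circleMobius ha) := by
  refine continuous_induced_rng.2 ?_
  exact (analyticOnNhd_mobius ha).continuousOn.comp_continuous continuous_coe_circle
    fun s => by simp [norm_circle]

theorem map_circleMobius (ha : a ∈ ball (0 : ℂ) 1) :
    circleProb.map (circleMobius ha) = poissonMeasure a := by
  have hm := (continuous_circleMobius ha).measurable
  have := isProbabilityMeasure_poissonMeasure ha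
  have := Measure.isProbabilityMeasure_map (μ := circleProb) hm.aemeasurable
  have hpow : ∀ k : ℕ, ∫ s : Circle, (s : ℂ) ^ k ∂circleProb.map (circleMobius ha) =
      ∫ s : Circle, (s : ℂ) ^ k ∂poissonMeasure a := fun k => by
    have hc : Continuous fun s : Circle => (s : ℂ) ^ k := by fun_prop
    rw [integral_map hm.aemeasurable hc.aestronglyMeasurable, integral_poissonMeasure ha]
    have hd : Differentiable ℂ fun z : ℂ => z ^ k := by fun_prop
    rw [poisson_of_diffContOnCl hd.diffContOnCl ha]
    simp only [coe_circleMobius]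
    have hdm : DifferentiableOn ℂ (fun z => mobius a z ^ k) (closedBall 0 1) :=
      (analyticOnNhd_mobius ha).differentiableOn.pow k
    have hdc : DiffContOnCl ℂ (fun z => mobius a z ^ k) (ball 0 |1|) := by
      rw [abs_one]
      exact ⟨hdm.mono ball_subset_closedBall,
        hdm.continuousOn.mono closure_ball_subset_closedBall⟩
    have := hdc.circleAverage
    rw [circleAverage_eq_integral, mobius_zero] at this
    · exact this
    · exact (hdm.continuousOn.comp_continuous continuous_coe_circle
        fun s => by simp [norm_circle]).aestronglyMeasurable
  refine measure_circle_ext fun k => ?_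
  obtain ⟨m, rfl | rfl⟩ := k.eq_nat_or_neg
  · simpa using hpow m
  · have hconj : ∀ s : Circle, (s : ℂ) ^ (-(m : ℤ)) = (starRingEnd ℂ) ((s : ℂ) ^ m) := fun s => by
      rw [map_pow, ← Circle.coe_inv_eq_conj, Circle.coe_inv, zpow_neg, zpow_natCast, inv_pow]
    simp only [hconj, integral_conj, hpow m]

end Mobius

section Growth

variable {n : ℕ} {p : ℝ} {φ : Circle → Cn n → ℝ}

theorem MemLp.integrable_norm_rpow_ofReal {F : Type*} [NormedAddCommGroup F] (hp : 1 < p)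
    {f : Circle → F} (hf : MemLp f (ENNReal.ofReal p) circleProb) :
    Integrable (fun s => ‖f s‖ ^ p) circleProb := by
  have := hf.integrable_norm_rpow (by simp; linarith) ENNReal.ofReal_ne_top
  rwa [ENNReal.toReal_ofReal (by linarith)] at this

theorem UniformGrowth.exists_abs_le (hφ : UniformGrowth p φ) :
    ∃ C A : ℝ, 0 < C ∧ 0 < A ∧ ∀ s w, |φ s w| ≤ C * ‖w‖ ^ p + A := by
  obtain ⟨c, C, A, hc, hC, hA, h⟩ := hφ
  refine ⟨C, A, hC, hA, fun s w => abs_le.2 ⟨?_, (h s w).2⟩⟩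
  have h1 : 0 ≤ ‖w‖ ^ p := Real.rpow_nonneg (norm_nonneg _) _
  have := (h s w).1
  nlinarith

theorem aestronglyMeasurable_comp (hmeas : Measurable (fun x : Circle × Cn n => φ x.1 x.2))
    {f : Circle → Cn n} (hf : AEStronglyMeasurable f circleProb) :
    AEStronglyMeasurable (fun s => φ s (f s)) circleProb :=
  (hmeas.comp_aemeasurable (aemeasurable_id.prodMk hf.aemeasurable)).aestronglyMeasurable

theorem integrable_comp (hp : 1 < p) (hmeas : Measurable (fun x : Circle × Cn n => φ x.1 x.2))
    (hφ : UniformGrowth p φ) {f : Circle → Cn n} (hf : MemLp f (ENNReal.ofReal p) circleProb) :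
    Integrable (fun s => φ s (f s)) circleProb := by
  obtain ⟨C, A, -, -, h⟩ := hφ.exists_abs_le
  exact (((MemLp.integrable_norm_rpow_ofReal hp hf).const_mul C).add (integrable_const A)).mono'
    (aestronglyMeasurable_comp hmeas hf.1) (Eventually.of_forall fun s => h s (f s))

end Growth

section Perron

variable {n : ℕ} {p : ℝ} {φ : Circle → Cn n → ℝ} {t : ℂ}

/-- The sub-mean value property of a plurisubharmonic function on the dilations of a graph, with
respect to harmonic measure. -/
theorem IsPSH.le_poisson {u : ℂ → Cn n → ℝ}
    (hu : IsPSH (ball (0 : ℂ) 1 ×ˢ (univ : Set (Cn n))) (fun y : ℂ × Cn n => u y.1 y.2))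
    {F : ℂ → Cn n} (hF : DifferentiableOn ℂ F (ball 0 1)) {r : ℝ} (hr : r ∈ Ioo 0 1)
    (htr : ‖t‖ < r) :
    Measurable (fun s : Circle => u (r * s) (F (r * s))) ∧
      Integrable (fun s : Circle => poissonKernel 0 (t / r) s • u (r * s) (F (r * s))) circleProb ∧
      u t (F t) ≤ poisson (fun s : Circle => u (r * s) (F (r * s))) (t / r) := by
  have hr0 : (r : ℂ) ≠ 0 := by exact_mod_cast hr.1.ne'
  have ha : t / r ∈ ball (0 : ℂ) 1 := by
    rw [mem_ball_zero_iff, norm_div, Complex.norm_real, Real.norm_of_nonneg hr.1.le,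
      div_lt_one hr.1]
    exact htr
  have hmaps : ∀ z : ℂ, ‖z‖ ≤ 1 → (r : ℂ) * z ∈ ball (0 : ℂ) 1 := fun z hz => by
    rw [mem_ball_zero_iff, norm_mul, Complex.norm_real, Real.norm_of_nonneg hr.1.le]
    nlinarith [hr.1, hr.2]
  set h : Circle → ℝ := fun s => u (r * s) (F (r * s)) with hh
  have hmeas : Measurable h := by
    have hc : Continuous (fun s : Circle => ((r : ℂ) * s, F (r * s))) := by
      refine Continuous.prodMk (by fun_prop) ?_
      exact hF.continuousOn.comp_continuous (by fun_prop) fun s => hmaps s (norm_circle s).le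
    have := hu.1.comp (t := univ) hc.continuousOn
      fun s _ => ⟨hmaps s (norm_circle s).le, mem_univ _⟩
    rw [upperSemicontinuousOn_univ_iff] at this
    exact this.measurable
  have hga : AnalyticOnNhd ℂ (fun τ => (((r : ℂ) * mobius (t / r) τ,
      F ((r : ℂ) * mobius (t / r) τ)) : ℂ × Cn n)) (closedBall 0 1) := by
    have h1 : AnalyticOnNhd ℂ (fun τ => (r : ℂ) * mobius (t / r) τ) (closedBall 0 1) :=
      analyticOnNhd_const.mul (analyticOnNhd_mobius ha)
    refine h1.prod ?_
    exact (hF.analyticOnNhd isOpen_ball).comp h1 fun τ hτ => hmaps _ (norm_mobius_le ha hτ)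
  obtain ⟨hci, hle⟩ := hu.2 _ hga fun τ hτ => ⟨hmaps _ (norm_mobius_le ha hτ), mem_univ _⟩
  have hM := (continuous_circleMobius ha).measurable
  have hcomp : (fun s : Circle => u ((r : ℂ) * mobius (t / r) s) (F ((r : ℂ) * mobius (t / r) s))) =
      h ∘ circleMobius ha := by
    ext s
    simp only [hh, Function.comp, coe_circleMobius]
  have hae : AEStronglyMeasurable (fun s : Circle => u ((r : ℂ) * mobius (t / r) s)
      (F ((r : ℂ) * mobius (t / r) s))) circleProb := by
    rw [hcomp]
    exact (hmeas.comp hM).aestronglyMeasurable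
  refine ⟨hmeas, ?_, ?_⟩
  · rw [circleIntegrable_iff hae, hcomp, ← integrable_map_measure hmeas.aestronglyMeasurable
      hM.aemeasurable, map_circleMobius, integrable_poissonMeasure ha] at hci
    exact hci
  · rw [circleAverage_eq_integral hae, hcomp] at hle
    simp only [mobius_zero, mul_div_cancel₀ _ hr0] at hle
    refine hle.trans (le_of_eq ?_)
    rw [← integral_poissonMeasure ha, ← map_circleMobius ha,
      integral_map hM.aemeasurable hmeas.aestronglyMeasurable]
    rfl

theorem perron_le_poisson (hp : 1 < p) (hmeas : Measurable (fun x : Circle × Cn n => φ x.1 x.2))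
    (hφ : UniformGrowth p φ) {u : ℂ → Cn n → ℝ}
    (hu : IsPSH (ball (0 : ℂ) 1 ×ˢ (univ : Set (Cn n))) (fun y : ℂ × Cn n => u y.1 y.2))
    (hsup : ∀ t' ∈ ball (0 : ℂ) 1, ∀ w' : Cn n, (u t' w' : EReal) ≤ ⨆ s : Circle, (φ s w' : EReal))
    (hle : BoundaryLE u φ) {f : Circle → Cn n} (hf : IsHardy p f) (ht : t ∈ ball (0 : ℂ) 1) :
    u t (poisson f t) ≤ poisson (fun s => φ s (f s)) t := by
  obtain ⟨C, A, hC, hA, hgr⟩ := hφ.exists_abs_le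
  have hfi := hf.integrable hp
  have hfp := MemLp.integrable_norm_rpow_ofReal hp hf.1
  have hφi := integrable_comp hp hmeas hφ hf.1
  have ht1 : ‖t‖ < 1 := by simpa using ht
  obtain ⟨r, -, hrt, hlim⟩ := exists_seq_strictMono_tendsto' ht1
  have hr : ∀ k, r k ∈ Ioo (0 : ℝ) 1 := fun k => ⟨(norm_nonneg t).trans_lt (hrt k).1, (hrt k).2⟩
  have hlim' : Tendsto r atTop (𝓝[<] 1) :=
    tendsto_nhdsWithin_iff.2 ⟨hlim, Eventually.of_forall fun k => (hr k).2⟩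
  have hub : ∀ t' ∈ ball (0 : ℂ) 1, ∀ w', u t' w' ≤ C * ‖w'‖ ^ p + A := fun t' ht' w' => by
    have : (u t' w' : EReal) ≤ ((C * ‖w'‖ ^ p + A : ℝ) : EReal) :=
      (hsup t' ht' w').trans (iSup_le fun s =>
        EReal.coe_le_coe_iff.2 ((le_abs_self _).trans (hgr s w')))
    exact EReal.coe_le_coe_iff.1 this
  have htr : ∀ k, t / r k ∈ ball (0 : ℂ) 1 := fun k => by
    rw [mem_ball_zero_iff, norm_div, Complex.norm_real, Real.norm_of_nonneg (hr k).1.le,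
      div_lt_one (hr k).1]
    exact (hrt k).1
  have hball : ∀ k (s : Circle), (r k : ℂ) * s ∈ ball (0 : ℂ) 1 :=
    fun k s => real_mul_circle_mem_ball (hr k) s
  set U : ℕ → Circle → ℝ := fun k s => u (r k * s) (poisson f (r k * s)) with hU
  set N : ℕ → Circle → ℝ := fun k s => ‖poisson f (r k * s)‖ ^ p with hN
  set D : ℕ → Circle → ℝ := fun k s =>
    poissonKernel 0 (t / r k) s * (C * N k s + A - U k s) with hD
  set D0 : Circle → ℝ := fun s => poissonKernel 0 t s * (C * ‖f s‖ ^ p + A - φ s (f s)) with hD0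
  have hpsh := fun k => hu.le_poisson (t := t) hf.2 (hr k) (hrt k).1
  have hNc : ∀ k, Continuous (N k) := fun k => by
    have hc : Continuous (fun s : Circle => poisson f (r k * s)) :=
      hf.2.continuousOn.comp_continuous (by fun_prop) fun s => hball k s
    exact (Real.continuous_rpow_const (by linarith)).comp hc.norm
  have hNi : ∀ k, Integrable (N k) circleProb := fun k => by
    simpa using integrable_continuous_smul (hNc k) (integrable_const (1 : ℝ))
  have hDnn : ∀ k s, 0 ≤ D k s := fun k s =>
    mul_nonneg (poissonKernel_pos (htr k) s).le (sub_nonneg.2 (hub _ (hball k s) _))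
  have hD0nn : ∀ s, 0 ≤ D0 s := fun s =>
    mul_nonneg (poissonKernel_pos ht s).le (sub_nonneg.2 ((le_abs_self _).trans (hgr s (f s))))
  have hDm : ∀ k, Measurable (D k) := fun k =>
    (measurable_poissonKernel _).mul (((hNc k).measurable.const_mul C).add_const A |>.sub (hpsh k).1)
  have hDsplit : ∀ k, D k = fun s : Circle => poissonKernel 0 (t / r k) s • (C * N k s + A) -
      poissonKernel 0 (t / r k) s • U k s := fun k => by
    ext s; simp only [hD, smul_eq_mul, mul_sub]
  have hDi : ∀ k, Integrable (D k) circleProb := fun k => by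
    rw [hDsplit k]
    exact (integrable_poissonKernel_smul (htr k)
      (((hNi k).const_mul C).add (integrable_const A))).sub (hpsh k).2.1
  have hPaff : ∀ {a : ℂ} (_ : a ∈ ball (0 : ℂ) 1) {h : Circle → ℝ} (_ : Integrable h circleProb),
      poisson (fun s => C * h s + A) a = C * poisson h a + A := fun ha h hh => by
    rw [poisson_add ha (hh.const_mul C) (integrable_const A), poisson_const ha]
    congr 1
    exact poisson_const_smul C h
  have hDint : ∀ k, ∫ s, D k s ∂circleProb ≤
      C * poisson (fun s => ‖f s‖ ^ p) t + A - u t (poisson f t) := fun k => by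
    have hNA : Integrable (fun s => C * N k s + A) circleProb :=
      ((hNi k).const_mul C).add (integrable_const A)
    have h0 : ∫ s, D k s ∂circleProb =
        poisson (fun s => C * N k s + A) (t / r k) - poisson (U k) (t / r k) :=
      (congrArg (fun g => ∫ s, g s ∂circleProb) (hDsplit k)).trans
        (integral_sub (integrable_poissonKernel_smul (htr k) hNA) (hpsh k).2.1)
    have h1 : poisson (fun s => C * N k s + A) (t / r k) ≤
        C * poisson (fun s => ‖f s‖ ^ p) t + A := by
      rw [hPaff (htr k) (hNi k), ← poisson_poisson (hr k) (hrt k).1 hfp]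
      have hcont : Continuous (fun s : Circle =>
          poisson (fun s => ‖f s‖ ^ p) ((r k : ℂ) * s)) := by
        obtain ⟨H, hH, hH2⟩ := exists_differentiableOn_re_eq_poisson hfp
        have : (fun s : Circle => poisson (fun s => ‖f s‖ ^ p) ((r k : ℂ) * s)) =
          fun s : Circle => (H ((r k : ℂ) * s)).re := by
          ext s; exact hH2 _ (hball k s)
        rw [this]
        exact Complex.continuous_re.comp
          (hH.continuousOn.comp_continuous (by fun_prop) fun s => hball k s)
      have := poisson_mono (htr k) (hNi k) (by
        simpa using integrable_continuous_smul hcont (integrable_const (1 : ℝ)))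
        (Eventually.of_forall fun s => norm_poisson_rpow_le hp.le (hball k s) hfi hfp)
      nlinarith
    have h2 := (hpsh k).2.2
    linarith
  have hD0int : ∫ s, D0 s ∂circleProb =
      C * poisson (fun s => ‖f s‖ ^ p) t + A - poisson (fun s => φ s (f s)) t := by
    have hi : Integrable (fun s => C * ‖f s‖ ^ p + A) circleProb :=
      (hfp.const_mul C).add (integrable_const A)
    rw [← hPaff ht hfp, ← poisson_sub ht hi hφi]
    rfl
  have hD0i : Integrable D0 circleProb :=
    integrable_poissonKernel_smul ht (((hfp.const_mul C).add (integrable_const A)).sub hφi)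
  have hliminf : ∀ᵐ s ∂circleProb,
      ENNReal.ofReal (D0 s) ≤ liminf (fun k => ENNReal.ofReal (D k s)) atTop := by
    filter_upwards [hle, ae_tendsto_poisson hfi] with s h1 h2
    have h2' := h2.comp hlim'
    have hPt : Tendsto (fun k => poissonKernel 0 (t / r k) s) atTop (𝓝 (poissonKernel 0 t s)) := by
      have h3 : Tendsto (fun k => t / (r k : ℂ)) atTop (𝓝 t) := by
        have := (tendsto_const_nhds (x := t)).div
          ((Complex.continuous_ofReal.tendsto 1).comp hlim) (by simp)
        rw [Complex.ofReal_one, div_one] at this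
        exact this
      exact (continuousAt_poissonKernel ht s).tendsto.comp h3
    have hNt : Tendsto (fun k => N k s) atTop (𝓝 (‖f s‖ ^ p)) :=
      ((Real.continuous_rpow_const (by linarith)).tendsto _).comp h2'.norm
    have hP0 := poissonKernel_pos ht s
    refine le_of_forall_lt fun c hc => ?_
    have hc' : c ≠ ⊤ := (hc.trans_le le_top).ne
    obtain ⟨d, hd0, rfl⟩ : ∃ d : ℝ, 0 ≤ d ∧ c = ENNReal.ofReal d :=
      ⟨c.toReal, ENNReal.toReal_nonneg, (ENNReal.ofReal_toReal hc').symm⟩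
    have hd := (ENNReal.ofReal_lt_ofReal_iff_of_nonneg hd0).1 hc
    obtain ⟨e, hde, he⟩ := exists_between hd
    set ε := (D0 s - e) / (2 * poissonKernel 0 t s) with hε
    have hε0 : 0 < ε := div_pos (by linarith) (by linarith)
    have hlt : limsup (fun x : ℝ × Cn n => (u ((x.1 : ℂ) * (s : ℂ)) x.2 : EReal))
        (𝓝[<] (1 : ℝ) ×ˢ 𝓝 (f s)) < ((φ s (f s) + ε : ℝ) : EReal) :=
      (h1 (f s)).trans_lt (EReal.coe_lt_coe_iff.2 (by linarith))
    have hev := (hlim'.prodMk h2').eventually (eventually_lt_of_limsup_lt hlt)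
    have hlow : Tendsto (fun k => poissonKernel 0 (t / r k) s *
        (C * N k s + A - (φ s (f s) + ε))) atTop
        (𝓝 (poissonKernel 0 t s * (C * ‖f s‖ ^ p + A - (φ s (f s) + ε)))) :=
      hPt.mul (((hNt.const_mul C).add_const A).sub_const _)
    have hval : poissonKernel 0 t s * (C * ‖f s‖ ^ p + A - (φ s (f s) + ε)) =
        (D0 s + e) / 2 := by
      have : poissonKernel 0 t s * ε = (D0 s - e) / 2 := by rw [hε]; field_simp
      have h5 : D0 s = poissonKernel 0 t s * (C * ‖f s‖ ^ p + A - φ s (f s)) := rfl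
      linear_combination (-1 : ℝ) * this - h5
    rw [hval] at hlow
    have hev2 := hlow.eventually (lt_mem_nhds (show e < (D0 s + e) / 2 by linarith))
    refine (ENNReal.ofReal_lt_ofReal_iff_of_nonneg hd0).2 hde |>.trans_le ?_
    refine le_liminf_of_le (by isBoundedDefault) ?_
    filter_upwards [hev, hev2] with k hk1 hk2
    refine ENNReal.ofReal_le_ofReal (hk2.le.trans ?_)
    refine mul_le_mul_of_nonneg_left ?_ (poissonKernel_pos (htr k) s).le
    have : U k s < φ s (f s) + ε := EReal.coe_lt_coe_iff.1 hk1
    linarith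
  have hfatou : ENNReal.ofReal (∫ s, D0 s ∂circleProb) ≤
      ENNReal.ofReal (C * poisson (fun s => ‖f s‖ ^ p) t + A - u t (poisson f t)) := by
    rw [ofReal_integral_eq_lintegral_ofReal hD0i (Eventually.of_forall hD0nn)]
    refine (lintegral_mono_ae hliminf).trans
      ((lintegral_liminf_le fun k => (hDm k).ennreal_ofReal).trans ?_)
    refine liminf_le_of_le (by isBoundedDefault) fun b hb => ?_
    obtain ⟨k, hk⟩ := hb.exists
    refine hk.trans ?_
    rw [← ofReal_integral_eq_lintegral_ofReal (hDi k) (Eventually.of_forall (hDnn k))]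
    exact ENNReal.ofReal_le_ofReal (hDint k)
  have hnn : 0 ≤ C * poisson (fun s => ‖f s‖ ^ p) t + A - u t (poisson f t) :=
    (integral_nonneg (hDnn 0)).trans (hDint 0)
  have := (ENNReal.ofReal_le_ofReal_iff hnn).1 hfatou
  rw [hD0int] at this
  linarith

theorem perronEnvelope_le_discEnvelope (hp : 1 < p)
    (hmeas : Measurable (fun x : Circle × Cn n => φ x.1 x.2)) (hφ : UniformGrowth p φ)
    (ht : t ∈ ball (0 : ℂ) 1) (w : Cn n) : perronEnvelope φ t w ≤ discEnvelope p φ t w := by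
  refine sSup_le ?_
  rintro x ⟨u, hu, hsup, hle, rfl⟩
  refine le_sInf ?_
  rintro y ⟨f, hf, rfl, rfl⟩
  exact EReal.coe_le_coe_iff.2 (perron_le_poisson hp hmeas hφ hu hsup hle hf ht)

end Perron

section HahnBanach

/-- A convex continuous function that is bounded below by `m` on an affine subspace is bounded below
by a continuous affine function that equals `m` on this subspace. -/
theorem exists_affine_le {E : Type*} [NormedAddCommGroup E] [NormedSpace ℝ E] {F : E → ℝ}
    (hconv : ConvexOn ℝ univ F) (hcont : Continuous F) (N : Submodule ℝ E) (x₀ : E) {m : ℝ}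
    (hm : ∀ y ∈ N, m ≤ F (x₀ + y)) :
    ∃ Λ : E →L[ℝ] ℝ, (∀ y ∈ N, Λ y = 0) ∧ ∀ x, m + Λ (x - x₀) ≤ F x := by
  have hS : Convex ℝ {x : E × ℝ | x.1 ∈ univ ∧ F x.1 < x.2} := hconv.convex_strict_epigraph
  have hSo : IsOpen {x : E × ℝ | x.1 ∈ univ ∧ F x.1 < x.2} := by
    simp only [mem_univ, true_and]
    exact isOpen_lt (hcont.comp continuous_fst) continuous_snd
  have hT : Convex ℝ ((fun y => (x₀ + y, m)) '' (N : Set E)) := by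
    rintro _ ⟨y, hy, rfl⟩ _ ⟨z, hz, rfl⟩ a b ha hb hab
    refine ⟨a • y + b • z, N.add_mem (N.smul_mem _ hy) (N.smul_mem _ hz), ?_⟩
    refine Prod.ext ?_ ?_
    · change x₀ + (a • y + b • z) = a • (x₀ + y) + b • (x₀ + z)
      nth_rw 1 [← one_smul ℝ x₀, ← hab]
      module
    · change m = a * m + b * m
      rw [← add_mul, hab, one_mul]
  have hdisj : Disjoint {x : E × ℝ | x.1 ∈ univ ∧ F x.1 < x.2}
      ((fun y => (x₀ + y, m)) '' (N : Set E)) := by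
    rw [Set.disjoint_left]
    rintro _ hx ⟨y, hy, rfl⟩
    exact absurd hx.2 (not_lt.2 (hm y hy))
  obtain ⟨f, c, hf1, hf2⟩ := geometric_hahn_banach_open hS hSo hT hdisj
  set β := f (0, 1) with hβ
  have hsplit : ∀ x r, f (x, r) = f (x, 0) + r * β := fun x r => by
    have : ((x, r) : E × ℝ) = (x, 0) + r • (0, 1) := by ext <;> simp
    rw [this, map_add, map_smul, smul_eq_mul]
  have h1 : ∀ x r, F x < r → ∀ y ∈ N, f (x, 0) + r * β < f (x₀, 0) + f (y, 0) + m * β := by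
    intro x r hr y hy
    have h2 := hf1 (x, r) ⟨mem_univ _, hr⟩
    have h3 := hf2 _ ⟨y, hy, rfl⟩
    simp only at h3
    rw [hsplit] at h2 h3
    have : ((x₀ + y, 0) : E × ℝ) = (x₀, 0) + (y, 0) := by simp
    rw [this, map_add] at h3
    linarith
  have hβ0 : β < 0 := by
    have h2 := hm 0 N.zero_mem
    rw [add_zero] at h2
    have h3 := h1 x₀ (F x₀ + 1) (by linarith) 0 N.zero_mem
    have h4 : f ((0 : E), (0 : ℝ)) = 0 := map_zero f
    rw [h4] at h3
    nlinarith
  have hN : ∀ y ∈ N, f (y, 0) = 0 := by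
    intro y hy
    by_contra hne
    set K := f (x₀, 0) + (F x₀ + 1) * β - f (x₀, 0) - m * β with hK
    have h2 := h1 x₀ (F x₀ + 1) (by linarith) ((K / f (y, 0)) • y) (N.smul_mem _ hy)
    have h3 : f ((K / f (y, 0)) • y, (0 : ℝ)) = K := by
      have : (((K / f (y, 0)) • y, 0) : E × ℝ) = (K / f (y, 0)) • (y, 0) := by simp
      rw [this, map_smul, smul_eq_mul, div_mul_cancel₀ _ hne]
    rw [h3] at h2
    linarith
  refine ⟨(-β)⁻¹ • f.comp (ContinuousLinearMap.inl ℝ E ℝ), fun y hy => ?_, fun x => ?_⟩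
  · simp [hN y hy]
  · refine le_of_forall_gt_imp_ge_of_dense fun r hr => ?_
    have h2 := h1 x r hr 0 N.zero_mem
    have h4 : f ((0 : E), (0 : ℝ)) = 0 := map_zero f
    rw [h4] at h2
    have h5 : f (x - x₀, (0 : ℝ)) = f (x, 0) - f (x₀, 0) := by
      rw [← map_sub]; simp
    have h6 : ((-β)⁻¹ • f.comp (ContinuousLinearMap.inl ℝ E ℝ)) (x - x₀) =
        (f (x, 0) - f (x₀, 0)) / (-β) := by
      rw [← h5]
      simp [div_eq_inv_mul]
    rw [h6]
    have : (f (x, 0) - f (x₀, 0)) / (-β) ≤ r - m := by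
      rw [div_le_iff₀ (by linarith)]
      nlinarith
    linarith

end HahnBanach

section Riesz

variable {α : Type*} [MeasurableSpace α] {μ : Measure α} [IsFiniteMeasure μ] {p : ENNReal}
  [Fact (1 ≤ p)]

theorem hasSum_indicatorConstLp {V : Type*} [NormedAddCommGroup V] (hp : p ≠ ⊤)
    (v : V) {f : ℕ → Set α} (hf : ∀ i, MeasurableSet (f i))
    (hd : Pairwise (Function.onFun Disjoint f)) :
    HasSum (fun i => indicatorConstLp p (hf i) (measure_ne_top μ (f i)) v)
      (indicatorConstLp p (MeasurableSet.iUnion hf) (measure_ne_top μ _) v) := by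
  have hm : ∀ F : Finset ℕ, MeasurableSet (⋃ i ∈ F, f i) :=
    fun F => F.measurableSet_biUnion fun i _ => hf i
  have hsum : ∀ F : Finset ℕ, ∑ i ∈ F, indicatorConstLp p (hf i) (measure_ne_top μ (f i)) v =
      indicatorConstLp p (hm F) (measure_ne_top μ _) v := fun F => by
    classical
    induction F using Finset.induction_on with
    | empty => simp
    | insert a F ha ih =>
      rw [Finset.sum_insert ha, ih, ← indicatorConstLp_disjoint_union]
      · simp only [Finset.set_biUnion_insert]
      · rw [Set.disjoint_iUnion₂_right]
        intro i hi
        exact hd (fun h => ha (h ▸ hi))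
  change Tendsto _ _ _
  simp only [hsum]
  refine tendsto_indicatorConstLp_set hp ?_
  have h1 : ∀ F : Finset ℕ, μ (symmDiff (⋃ i ∈ F, f i) (⋃ i, f i)) =
      μ (⋃ i, f i) - ∑ i ∈ F, μ (f i) := fun F => by
    have hsub : (⋃ i ∈ F, f i) ⊆ ⋃ i, f i := iUnion₂_subset_iUnion _ _
    rw [Set.symmDiff_def, Set.sdiff_eq_empty.2 hsub, empty_union,
      measure_sdiff hsub (hm F).nullMeasurableSet (measure_ne_top μ _),
      measure_biUnion_finset (fun i _ j _ hij => hd hij) fun i _ => hf i]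
  simp only [h1]
  have h2 : HasSum (fun i => μ (f i)) (μ (⋃ i, f i)) := by
    rw [measure_iUnion hd hf]
    exact ENNReal.summable.hasSum
  have h3 := ENNReal.Tendsto.sub (tendsto_const_nhds (x := μ (⋃ i, f i)) (f := atTop)) h2
    (Or.inl (measure_ne_top μ _))
  rwa [tsub_self] at h3

theorem exists_density {V : Type*} [NormedAddCommGroup V] [NormedSpace ℝ V] (hp : p ≠ ⊤)
    (Λ : Lp V p μ →L[ℝ] ℝ) (v : V) :
    ∃ g : α → ℝ, Integrable g μ ∧ ∀ (E : Set α) (hE : MeasurableSet E),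
      Λ (indicatorConstLp p hE (measure_ne_top μ E) v) = ∫ x in E, g x ∂μ := by
  classical
  let ν : SignedMeasure α :=
    { measureOf' := fun E => if hE : MeasurableSet E then
        Λ (indicatorConstLp p hE (measure_ne_top μ E) v) else 0
      empty' := by simp
      not_measurable' := fun E hE => dif_neg hE
      m_iUnion' := fun f hf hd => by
        simp only [hf, MeasurableSet.iUnion hf, dif_pos]
        exact (hasSum_indicatorConstLp hp v hf hd).mapL Λ }
  have hν : ∀ (E : Set α) (hE : MeasurableSet E),
      ν E = Λ (indicatorConstLp p hE (measure_ne_top μ E) v) := fun E hE => dif_pos hE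
  have hac : ν.AbsolutelyContinuous μ.toENNRealVectorMeasure := by
    refine VectorMeasure.AbsolutelyContinuous.mk fun E hE h0 => ?_
    rw [Measure.toENNRealVectorMeasure_apply_measurable hE] at h0
    rw [hν E hE]
    have : indicatorConstLp p hE (measure_ne_top μ E) v = 0 := by
      have h2 : E =ᵐ[μ] (∅ : Set α) := ae_eq_empty.2 h0
      have h3 := indicator_ae_eq_of_ae_eq_set (f := fun _ => v) h2
      rw [indicator_empty] at h3
      exact (MemLp.toLp_congr (memLp_indicator_const p hE v (Or.inr (measure_ne_top μ E)))
        MemLp.zero h3).trans (MemLp.toLp_zero _)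
    rw [this, map_zero]
  refine ⟨ν.rnDeriv μ, SignedMeasure.integrable_rnDeriv ν μ, fun E hE => ?_⟩
  rw [← hν E hE, ← withDensityᵥ_apply (SignedMeasure.integrable_rnDeriv ν μ) hE,
    SignedMeasure.withDensityᵥ_rnDeriv_eq ν μ hac]

theorem MemLp.of_measurable_of_bound {α : Type*} [MeasurableSpace α] {μ : Measure α}
    [IsFiniteMeasure μ] {p : ENNReal} {V : Type*} [NormedAddCommGroup V] [MeasurableSpace V]
    [BorelSpace V] [SecondCountableTopology V] {h : α → V} (hh : Measurable h) {B : ℝ}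
    (hB : ∀ s, ‖h s‖ ≤ B) : MemLp h p μ :=
  MemLp.of_bound hh.aestronglyMeasurable B (Eventually.of_forall hB)

theorem aestronglyMeasurable_re_dot {α : Type*} [MeasurableSpace α] {μ : Measure α} {n : ℕ}
    {a b : α → Cn n} (ha : AEStronglyMeasurable a μ)
    (hb : AEStronglyMeasurable b μ) : AEStronglyMeasurable (fun s => (dot (a s) (b s)).re) μ := by
  refine Complex.continuous_re.comp_aestronglyMeasurable ?_
  unfold dot
  refine Finset.aestronglyMeasurable_fun_sum _ fun j _ => AEStronglyMeasurable.mul ?_ ?_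
  · exact (PiLp.continuous_apply 2 _ j).comp_aestronglyMeasurable ha
  · exact (PiLp.continuous_apply 2 _ j).comp_aestronglyMeasurable hb

/-- A continuous real functional on `L^p(μ, ℂⁿ)` is given on bounded functions by integration
against an integrable function. -/
theorem exists_riesz {n : ℕ} (hp : p ≠ ⊤) (Λ : Lp (Cn n) p μ →L[ℝ] ℝ) :
    ∃ G : α → Cn n, Integrable G μ ∧ ∀ (h : α → Cn n) (hh : Measurable h) (B : ℝ)
      (hB : ∀ s, ‖h s‖ ≤ B),
      Λ ((MemLp.of_measurable_of_bound hh hB : MemLp h p μ).toLp h) =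
        ∫ s, (dot (G s) (h s)).re ∂μ := by
  choose g hgi hg using exists_density hp Λ
  set e : Fin n → ℂ → Cn n := fun j c => EuclideanSpace.single j c with he
  set G : α → Cn n := fun s => WithLp.toLp 2 fun j =>
    (g (e j 1) s : ℂ) - (g (e j Complex.I) s : ℂ) * Complex.I with hG
  have hGi : Integrable G μ := by
    refine Integrable.of_eval_piLp fun j => ?_
    exact (hgi _).ofReal.sub ((hgi _).ofReal.mul_const _)
  have hre : ∀ v : Cn n, Integrable (fun s => (dot (G s) v).re) μ :=
    fun v => (reDot v).integrable_comp hGi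
  refine ⟨G, hGi, ?_⟩
  have hconst : ∀ (E : Set α) (hE : MeasurableSet E) (v : Cn n),
      Λ (indicatorConstLp p hE (measure_ne_top μ E) v) = ∫ s in E, (dot (G s) v).re ∂μ := by
    intro E hE v
    let T : Cn n →ₗ[ℝ] ℝ :=
      { toFun := fun v => Λ (indicatorConstLp p hE (measure_ne_top μ E) v)
        map_add' := fun v w => by rw [← indicatorConstLp_add, map_add]
        map_smul' := fun c v => by
          rw [RingHom.id_apply, ← map_smul]
          congr 1
          simp only [indicatorConstLp, indicator_const_smul]
          rfl }
    have hv : v = ∑ j, ((v j).re • e j 1 + (v j).im • e j Complex.I) := by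
      ext i
      simp [he, Pi.single_apply, Finset.sum_add_distrib, Complex.re_add_im]
    have hT : ∀ j c, T (e j c) = ∫ s in E, g (e j c) s ∂μ := fun j c => hg _ E hE
    have hdot : ∀ s, (dot (G s) v).re =
        ∑ j, ((v j).re * g (e j 1) s + (v j).im * g (e j Complex.I) s) := fun s => by
      rw [dot, Complex.re_sum]
      refine Finset.sum_congr rfl fun j _ => ?_
      simp [hG]
      ring
    change T v = _
    simp only [hdot]
    rw [integral_finsetSum _ fun j _ => (show Integrable (fun s => (v j).re * g (e j 1) s +
      (v j).im * g (e j Complex.I) s) (μ.restrict E) from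
        (((hgi _).const_mul _).add ((hgi _).const_mul _)).integrableOn)]
    conv_lhs => rw [hv]
    rw [map_sum]
    refine Finset.sum_congr rfl fun j _ => ?_
    rw [integral_add ((hgi _).const_mul _).integrableOn ((hgi _).const_mul _).integrableOn,
      integral_const_mul, integral_const_mul, map_add, map_smul, map_smul, hT, hT]
    rfl
  have hbdd : ∀ {h : α → Cn n} (_ : AEStronglyMeasurable h μ) {B : ℝ} (_ : ∀ s, ‖h s‖ ≤ B),
      Integrable (fun s => (dot (G s) (h s)).re) μ := fun {h} hh {B} hB => by
    have hm := aestronglyMeasurable_re_dot hGi.1 hh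
    refine (hGi.norm.mul_const B).mono' hm (Eventually.of_forall fun s => ?_)
    exact (Complex.abs_re_le_norm _).trans ((norm_dot_le _ _).trans
      (mul_le_mul_of_nonneg_left (hB s) (norm_nonneg _)))
  have hsimple : ∀ (h : SimpleFunc α (Cn n)) (hm : MemLp h p μ),
      Λ (hm.toLp h) = ∫ s, (dot (G s) (h s)).re ∂μ := by
    intro h
    induction h using SimpleFunc.induction with
    | @const v E hE =>
      intro hm
      have h1 := hconst _ hE v
      rw [← integral_indicator hE] at h1
      refine Eq.trans ?_ (h1.trans (integral_congr_ae (Eventually.of_forall fun s => ?_)))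
      · congr 1
      · by_cases hs : s ∈ E <;> simp [hs, dot, piecewise]
    | @add f₁ f₂ hd hf₁ hf₂ =>
      intro hm
      have m₁ : MemLp f₁ p μ := SimpleFunc.memLp_of_isFiniteMeasure f₁ p μ
      have m₂ : MemLp f₂ p μ := SimpleFunc.memLp_of_isFiniteMeasure f₂ p μ
      obtain ⟨B₁, hB₁⟩ := f₁.exists_forall_norm_le
      obtain ⟨B₂, hB₂⟩ := f₂.exists_forall_norm_le
      have h1 : hm.toLp (f₁ + f₂ : SimpleFunc α (Cn n)) = m₁.toLp f₁ + m₂.toLp f₂ := by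
        rw [← MemLp.toLp_add]
        rfl
      rw [h1, map_add, hf₁ m₁, hf₂ m₂, ← integral_add
        (hbdd f₁.aestronglyMeasurable hB₁) (hbdd f₂.aestronglyMeasurable hB₂)]
      refine integral_congr_ae (Eventually.of_forall fun s => ?_)
      simp only [SimpleFunc.coe_add, Pi.add_apply, dot_comm (G s)]
      exact ((reDot (G s)).map_add _ _).symm
  intro h hh B hB
  have hm : MemLp h p μ := MemLp.of_measurable_of_bound hh hB
  have h1 := (Λ.continuous.tendsto _).comp (SimpleFunc.tendsto_approxOn_range_Lp hp hh hm)
  refine tendsto_nhds_unique h1 ?_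
  simp only [Function.comp_def, hsimple]
  have hbound : ∀ k s, ‖SimpleFunc.approxOn h hh (range h ∪ {0}) 0 (by simp) k s‖ ≤ B + B :=
    fun k s => (SimpleFunc.norm_approxOn_zero_le hh _ s k).trans (add_le_add (hB s) (hB s))
  refine tendsto_integral_of_dominated_convergence (fun s => ‖G s‖ * (B + B))
    (fun k => (hbdd (SimpleFunc.aestronglyMeasurable _) (hbound k)).1) (hGi.norm.mul_const _)
    (fun k => Eventually.of_forall fun s => ?_) (Eventually.of_forall fun s => ?_)
  · exact (Complex.abs_re_le_norm _).trans ((norm_dot_le _ _).trans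
      (mul_le_mul_of_nonneg_left (hbound k s) (norm_nonneg _)))
  · refine (Complex.continuous_re.tendsto _).comp (tendsto_dot tendsto_const_nhds ?_)
    exact SimpleFunc.tendsto_approxOn hh _ (subset_closure (by simp))

end Riesz

section Dual

variable {n : ℕ} {p : ℝ} {φ : Circle → Cn n → ℝ}

theorem le_dualData (hp : 1 < p) (hφ : UniformGrowth p φ) (s : Circle) (z w : Cn n) :
    (dot z w).re - φ s w ≤ dualData φ s z := by
  have h := le_iSup (fun w : Cn n => (((dot z w).re : ℝ) : EReal) - φ s w) w
  rw [← EReal.coe_le_coe_iff, coe_dualData hp hφ, EReal.coe_sub]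
  exact h

theorem dualData_le (hp : 1 < p) (hφ : UniformGrowth p φ) {s : Circle} {z : Cn n} {M : ℝ}
    (h : ∀ w, (dot z w).re - φ s w ≤ M) : dualData φ s z ≤ M := by
  rw [← EReal.coe_le_coe_iff, coe_dualData hp hφ]
  refine iSup_le fun w => ?_
  rw [← EReal.coe_sub]
  exact EReal.coe_le_coe_iff.2 (h w)

theorem convexOn_dualData (hp : 1 < p) (hφ : UniformGrowth p φ) (s : Circle) :
    ConvexOn ℝ univ (dualData φ s) := by
  refine ⟨convex_univ, fun x _ y _ a b ha hb hab => dualData_le hp hφ fun w => ?_⟩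
  have h1 := mul_le_mul_of_nonneg_left (le_dualData hp hφ s x w) ha
  have h2 := mul_le_mul_of_nonneg_left (le_dualData hp hφ s y w) hb
  have h3 : (dot (a • x + b • y) w).re = a * (dot x w).re + b * (dot y w).re := by
    rw [← reDot_apply, map_add, map_smul, map_smul]; rfl
  have h4 : φ s w = a * φ s w + b * φ s w := by rw [← add_mul, hab, one_mul]
  simp only [smul_eq_mul]
  linarith

theorem continuous_of_convexOn {f : Cn n → ℝ} (hf : ConvexOn ℝ univ f) : Continuous f :=
  hf.locallyLipschitz.continuous

/-- The conjugate vector. -/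
noncomputable def conjVec (z : Cn n) : Cn n := WithLp.toLp 2 fun j => (starRingEnd ℂ) (z j)

theorem norm_conjVec (z : Cn n) : ‖conjVec z‖ = ‖z‖ := by
  simp [conjVec, EuclideanSpace.norm_eq]

theorem re_dot_conjVec (z : Cn n) : (dot z (conjVec z)).re = ‖z‖ ^ 2 := by
  rw [EuclideanSpace.norm_sq_eq, dot, Complex.re_sum]
  refine Finset.sum_congr rfl fun j _ => ?_
  simp [conjVec, Complex.mul_conj, Complex.normSq_eq_norm_sq]
  norm_cast

theorem one_lt_conj (hp : 1 < p) : 1 < p / (p - 1) := by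
  rw [lt_div_iff₀ (by linarith)]; linarith

theorem conj_conj (hp : 1 < p) : p / (p - 1) / (p / (p - 1) - 1) = p := by
  have : p - 1 ≠ 0 := by linarith
  field_simp
  ring_nf

theorem uniformGrowth_dualData (hp : 1 < p) (hφ : UniformGrowth p φ) :
    UniformGrowth (p / (p - 1)) (dualData φ) := by
  have hφ' := hφ
  obtain ⟨c, C, A, hc, hC, hA, h⟩ := hφ'
  have hp0 : 0 < p := by linarith
  have hp1 : 0 < p - 1 := by linarith
  set q := p / (p - 1) with hq
  have hq1 : 1 < q := one_lt_conj hp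
  have hpq : p.HolderConjugate q := Real.HolderConjugate.conjExponent hp
  set e : ℝ := (c * p) ^ (1 / p) with he
  have he0 : 0 < e := Real.rpow_pos_of_pos (by positivity) _
  have hep : e ^ p = c * p := by
    rw [he, ← Real.rpow_mul (by positivity), one_div_mul_cancel hp0.ne', Real.rpow_one]
  set ε : ℝ := (1 / (2 * C)) ^ (1 / (p - 1)) with hε
  have hε0 : 0 < ε := Real.rpow_pos_of_pos (by positivity) _
  have hεp : C * ε ^ p = ε / 2 := by
    have h1 : ε ^ (p - 1) = 1 / (2 * C) := by
      rw [hε, ← Real.rpow_mul (by positivity), one_div_mul_cancel hp1.ne', Real.rpow_one]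
    have h2 : ε ^ p = ε ^ (p - 1) * ε := by
      rw [← Real.rpow_add_one hε0.ne']; ring_nf
    rw [h2, h1]
    field_simp
  refine ⟨ε / 2, 1 / (e ^ q * q), A, by positivity, by positivity, hA, fun s z => ⟨?_, ?_⟩⟩
  · rcases eq_or_ne z 0 with rfl | hz
    · have h1 := le_dualData hp hφ s 0 0
      have h2 := (h s 0).2
      rw [norm_zero, Real.zero_rpow hp0.ne'] at h2
      rw [norm_zero, Real.zero_rpow (by linarith)]
      simp only [dot, PiLp.zero_apply, mul_zero, Finset.sum_const_zero, Complex.zero_re] at h1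
      linarith
    · have hz0 : 0 < ‖z‖ := norm_pos_iff.2 hz
      have h1 := le_dualData hp hφ s z ((ε * ‖z‖ ^ (q - 1) / ‖z‖) • conjVec z)
      have h2 := (h s ((ε * ‖z‖ ^ (q - 1) / ‖z‖) • conjVec z)).2
      have hr : 0 ≤ ε * ‖z‖ ^ (q - 1) / ‖z‖ := by positivity
      have h3 : ‖(ε * ‖z‖ ^ (q - 1) / ‖z‖) • conjVec z‖ = ε * ‖z‖ ^ (q - 1) := by
        rw [norm_smul, Real.norm_of_nonneg hr, norm_conjVec, div_mul_cancel₀ _ hz0.ne']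
      have h4 : (dot z ((ε * ‖z‖ ^ (q - 1) / ‖z‖) • conjVec z)).re = ε * ‖z‖ ^ q := by
        rw [dot_comm, ← reDot_apply, map_smul, reDot_apply, dot_comm, re_dot_conjVec, smul_eq_mul]
        have h5 : ‖z‖ ^ q = ‖z‖ ^ (q - 1) * ‖z‖ := by
          rw [← Real.rpow_add_one hz0.ne']; ring_nf
        rw [h5]
        field_simp
      have h6 : (ε * ‖z‖ ^ (q - 1)) ^ p = ε ^ p * ‖z‖ ^ q := by
        rw [Real.mul_rpow hε0.le (by positivity), ← Real.rpow_mul hz0.le]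
        congr 2
        rw [hq]
        field_simp
        ring
      rw [h3, h6] at h2
      rw [h4] at h1
      have h7 : C * (ε ^ p * ‖z‖ ^ q) = ε / 2 * ‖z‖ ^ q := by rw [← hεp]; ring
      linarith
  · refine dualData_le hp hφ fun w => ?_
    have h1 := Real.young_inequality_of_nonneg (a := e * ‖w‖) (b := ‖z‖ / e)
      (by positivity) (by positivity) hpq
    rw [Real.mul_rpow he0.le (norm_nonneg _), hep, Real.div_rpow (norm_nonneg _) he0.le] at h1
    have h2 : e * ‖w‖ * (‖z‖ / e) = ‖z‖ * ‖w‖ := by field_simp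
    have h3 : c * p * ‖w‖ ^ p / p = c * ‖w‖ ^ p := by field_simp
    have h4 : ‖z‖ ^ q / e ^ q / q = 1 / (e ^ q * q) * ‖z‖ ^ q := by
      have : 0 < e ^ q := by positivity
      field_simp
    rw [h2, h3, h4] at h1
    have h5 := (h s w).1
    have h6 := (Complex.re_le_norm _).trans (norm_dot_le z w)
    linarith

/-- Real functionals on `ℂⁿ` are of the form `Re (z · w)`. -/
theorem exists_reDot (Λ : Cn n →L[ℝ] ℝ) : ∃ z : Cn n, ∀ w, Λ w = (dot z w).re := by
  refine ⟨WithLp.toLp 2 fun j => (Λ (EuclideanSpace.single j 1) : ℂ) -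
    (Λ (EuclideanSpace.single j Complex.I) : ℂ) * Complex.I, fun w => ?_⟩
  have hw : w = ∑ j, ((w j).re • EuclideanSpace.single j (1 : ℂ) +
      (w j).im • EuclideanSpace.single j Complex.I) := by
    ext i
    simp [Pi.single_apply, Finset.sum_add_distrib, Complex.re_add_im]
  conv_lhs => rw [hw]
  rw [map_sum, dot, Complex.re_sum]
  refine Finset.sum_congr rfl fun j _ => ?_
  rw [map_add, map_smul, map_smul]
  simp
  ring

theorem le_of_dualData (hp : 1 < p) (hφ : UniformGrowth p φ) {s : Circle}
    (hconv : ConvexOn ℝ univ (φ s)) {w : Cn n} {M : ℝ}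
    (h : ∀ z, (dot w z).re - M ≤ dualData φ s z) : φ s w ≤ M := by
  obtain ⟨Λ, -, hΛ⟩ := exists_affine_le hconv (continuous_of_convexOn hconv) ⊥ w
    (m := φ s w) (fun y hy => by rw [(Submodule.mem_bot ℝ).1 hy, add_zero])
  obtain ⟨z, hz⟩ := exists_reDot Λ
  have h1 : dualData φ s z ≤ (dot z w).re - φ s w := dualData_le hp hφ fun x => by
    have := hΛ x
    rw [map_sub, hz, hz] at this
    linarith
  have := h z
  rw [dot_comm] at this
  linarith

end Dual

section Selection

variable {n : ℕ} {p : ℝ} {φ : Circle → Cn n → ℝ}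

/-- The value of the concave function `w ↦ Re (z · w) - φ_s(w)`. -/
noncomputable def dualValue (φ : Circle → Cn n → ℝ) (x : Circle × Cn n) (w : Cn n) : ℝ :=
  (dot x.2 w).re - φ x.1 w

open scoped Classical in
/-- A maximizer of `w ↦ Re (z · w) - φ_s(w)` among the first `k + 1` terms of a dense sequence. -/
noncomputable def dualSelect (φ : Circle → Cn n → ℝ) : ℕ → Circle × Cn n → Cn n
  | 0, _ => TopologicalSpace.denseSeq (Cn n) 0
  | k + 1, x =>
    if dualValue φ x (dualSelect φ k x) ≤ dualValue φ x (TopologicalSpace.denseSeq (Cn n) (k + 1)) then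
      TopologicalSpace.denseSeq (Cn n) (k + 1) else dualSelect φ k x

theorem measurable_dualValue_comp (hmeas : Measurable (fun x : Circle × Cn n => φ x.1 x.2))
    {f : Circle × Cn n → Cn n} (hf : Measurable f) : Measurable fun x => dualValue φ x (f x) := by
  refine Measurable.sub ?_ (hmeas.comp (measurable_fst.prodMk hf))
  refine Complex.measurable_re.comp ?_
  unfold dot
  refine Finset.measurable_fun_sum _ fun j _ => Measurable.mul ?_ ?_
  · exact (PiLp.continuous_apply 2 (fun _ : Fin n => ℂ) j).measurable.comp measurable_snd
  · exact (PiLp.continuous_apply 2 (fun _ : Fin n => ℂ) j).measurable.comp hf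

theorem measurable_dualSelect (hmeas : Measurable (fun x : Circle × Cn n => φ x.1 x.2)) (k : ℕ) :
    Measurable (dualSelect φ k) := by
  induction k with
  | zero => exact measurable_const
  | succ k ih =>
    exact Measurable.ite (measurableSet_le (measurable_dualValue_comp hmeas ih)
      (measurable_dualValue_comp hmeas measurable_const)) measurable_const ih

theorem exists_norm_dualSelect_le (φ : Circle → Cn n → ℝ) (k : ℕ) :
    ∃ B, ∀ x, ‖dualSelect φ k x‖ ≤ B := by
  induction k with
  | zero => exact ⟨‖TopologicalSpace.denseSeq (Cn n) 0‖, fun _ => le_rfl⟩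
  | succ k ih =>
    obtain ⟨B, hB⟩ := ih
    refine ⟨max B ‖TopologicalSpace.denseSeq (Cn n) (k + 1)‖, fun x => ?_⟩
    rw [dualSelect]
    split_ifs
    exacts [le_max_right _ _, (hB x).trans (le_max_left _ _)]

theorem dualValue_select_succ (x : Circle × Cn n) (k : ℕ) :
    dualValue φ x (dualSelect φ (k + 1) x) =
      max (dualValue φ x (dualSelect φ k x)) (dualValue φ x (TopologicalSpace.denseSeq (Cn n) (k + 1))) := by
  rw [dualSelect]
  split_ifs with h
  exacts [(max_eq_right h).symm, (max_eq_left (not_le.1 h).le).symm]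

theorem monotone_dualValue_select (x : Circle × Cn n) :
    Monotone fun k => dualValue φ x (dualSelect φ k x) :=
  monotone_nat_of_le_succ fun k => by
    rw [dualValue_select_succ]; exact le_max_left _ _

theorem le_dualValue_select (x : Circle × Cn n) (k : ℕ) :
    dualValue φ x (TopologicalSpace.denseSeq (Cn n) k) ≤ dualValue φ x (dualSelect φ k x) := by
  cases k with
  | zero => exact le_rfl
  | succ k => rw [dualValue_select_succ]; exact le_max_right _ _

theorem tendsto_dualValue_select (hp : 1 < p) (hφ : UniformGrowth p φ)
    (hconv : ∀ s, ConvexOn ℝ univ (φ s)) (x : Circle × Cn n) :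
    Tendsto (fun k => dualValue φ x (dualSelect φ k x)) atTop (𝓝 (dualData φ x.1 x.2)) := by
  refine tendsto_atTop_isLUB (monotone_dualValue_select x) ⟨?_, fun M hM => ?_⟩
  · rintro _ ⟨k, rfl⟩
    exact le_dualData hp hφ _ _ _
  · refine dualData_le hp hφ fun w => ?_
    have hc : Continuous fun w => (dot x.2 w).re - φ x.1 w := by
      refine Continuous.sub ?_ (continuous_of_convexOn (hconv _))
      simp only [dot_comm x.2]
      exact (reDot x.2).continuous
    refine (isClosed_le hc continuous_const).closure_subset_iff.2 ?_
      ((TopologicalSpace.denseRange_denseSeq (Cn n)) w)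
    rintro _ ⟨k, rfl⟩
    exact (le_dualValue_select x k).trans (hM ⟨k, rfl⟩)

theorem measurable_dualData (hp : 1 < p) (hφ : UniformGrowth p φ)
    (hconv : ∀ s, ConvexOn ℝ univ (φ s))
    (hmeas : Measurable (fun x : Circle × Cn n => φ x.1 x.2)) :
    Measurable (fun x : Circle × Cn n => dualData φ x.1 x.2) :=
  measurable_of_tendsto_metrizable
    (fun k => measurable_dualValue_comp hmeas (measurable_dualSelect hmeas k))
    (tendsto_pi_nhds.2 (tendsto_dualValue_select hp hφ hconv))

end Selection

section Duality

variable {n : ℕ} {p : ℝ} {φ : Circle → Cn n → ℝ} {t : ℂ}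

theorem IsHardy.congr_ae {f g : Circle → Cn n} (hf : IsHardy p f) (h : f =ᵐ[circleProb] g) :
    IsHardy p g :=
  ⟨hf.1.ae_eq h, hf.2.congr fun _ _ => poisson_congr_ae h.symm⟩

/-- The functional `f ↦ P[φ(s, f(s))](t)` on `L^p`. -/
noncomputable def poissonFunctional (p : ℝ) (φ : Circle → Cn n → ℝ) (t : ℂ)
    (f : Lp (Cn n) (ENNReal.ofReal p) circleProb) : ℝ :=
  poisson (fun s => φ s (f s)) t

theorem poissonFunctional_toLp {f : Circle → Cn n}
    (hf : MemLp f (ENNReal.ofReal p) circleProb) :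
    poissonFunctional p φ t (hf.toLp f) = poisson (fun s => φ s (f s)) t :=
  poisson_congr_ae (hf.coeFn_toLp.mono fun s hs => by simp only [hs])

theorem convexOn_poissonFunctional (hp : 1 < p)
    (hmeas : Measurable (fun x : Circle × Cn n => φ x.1 x.2))
    (hconv : ∀ s, ConvexOn ℝ univ (φ s)) (hφ : UniformGrowth p φ) (ht : t ∈ ball (0 : ℂ) 1) :
    ConvexOn ℝ univ (poissonFunctional p φ t) := by
  refine ⟨convex_univ, fun f _ g _ a b ha hb hab => ?_⟩
  have hi : ∀ f : Lp (Cn n) (ENNReal.ofReal p) circleProb,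
      Integrable (fun s => φ s (f s)) circleProb :=
    fun f => integrable_comp hp hmeas hφ (Lp.memLp f)
  have h1 : a • poissonFunctional p φ t f + b • poissonFunctional p φ t g =
      poisson (fun s => a * φ s (f s) + b * φ s (g s)) t := by
    rw [poisson_add ht ((hi f).const_mul a) ((hi g).const_mul b)]
    exact congrArg₂ _ (poisson_const_smul a _).symm (poisson_const_smul b _).symm
  rw [h1]
  refine poisson_mono ht (hi _) (((hi f).const_mul a).add ((hi g).const_mul b)) ?_
  filter_upwards [Lp.coeFn_add (a • f) (b • g), Lp.coeFn_smul a f, Lp.coeFn_smul b g]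
    with s h2 h3 h4
  rw [h2, Pi.add_apply, h3, h4]
  exact (hconv s).2 (mem_univ _) (mem_univ _) ha hb hab

theorem integral_norm_rpow_eq (hp : 1 < p) (f : Lp (Cn n) (ENNReal.ofReal p) circleProb) :
    ∫ s, ‖f s‖ ^ p ∂circleProb = ‖f‖ ^ p := by
  have h0 : ENNReal.ofReal p ≠ 0 := by simp; linarith
  have h1 := (Lp.memLp f).eLpNorm_eq_integral_rpow_norm h0 ENNReal.ofReal_ne_top
  rw [ENNReal.toReal_ofReal (by linarith)] at h1
  have h2 : 0 ≤ ∫ s, ‖f s‖ ^ p ∂circleProb :=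
    integral_nonneg fun s => Real.rpow_nonneg (norm_nonneg _) _
  rw [Lp.norm_def, h1, ENNReal.toReal_ofReal (Real.rpow_nonneg h2 _), ← Real.rpow_mul h2,
    inv_mul_cancel₀ (by linarith), Real.rpow_one]

theorem continuous_poissonFunctional [Fact (1 ≤ ENNReal.ofReal p)] (hp : 1 < p)
    (hmeas : Measurable (fun x : Circle × Cn n => φ x.1 x.2))
    (hconv : ∀ s, ConvexOn ℝ univ (φ s)) (hφ : UniformGrowth p φ) (ht : t ∈ ball (0 : ℂ) 1) :
    Continuous (poissonFunctional p φ t) := by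
  have hcv := convexOn_poissonFunctional hp hmeas hconv hφ ht
  rw [← continuousOn_univ]
  suffices h : ∃ x₀ ∈ univ, (𝓝 x₀).IsBoundedUnder (· ≤ ·) (poissonFunctional p φ t) from
    ((hcv.continuousOn_tfae isOpen_univ univ_nonempty).out 3 1).1 h
  refine ⟨0, mem_univ _, ?_⟩
  obtain ⟨C, A, hC, hA, hgr⟩ := hφ.exists_abs_le
  have ht1 : ‖t‖ < 1 := by simpa using ht
  refine ⟨2 / (1 - ‖t‖) * (C + A), ?_⟩
  rw [eventually_map]
  filter_upwards [closedBall_mem_nhds (0 : Lp (Cn n) (ENNReal.ofReal p) circleProb) one_pos]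
    with f hf
  rw [mem_closedBall_zero_iff] at hf
  have hfp := MemLp.integrable_norm_rpow_ofReal hp (Lp.memLp f)
  have hi := integrable_comp hp hmeas hφ (Lp.memLp f)
  have hi2 : Integrable (fun s => 2 / (1 - ‖t‖) * (C * ‖f s‖ ^ p + A)) circleProb :=
    ((hfp.const_mul C).add (integrable_const A)).const_mul _
  have h1 : poissonFunctional p φ t f ≤
      ∫ s, 2 / (1 - ‖t‖) * (C * ‖f s‖ ^ p + A) ∂circleProb := by
    refine integral_mono (integrable_poissonKernel_smul ht hi) hi2 fun s => ?_
    have h2 : 0 ≤ C * ‖f s‖ ^ p + A := by positivity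
    exact (mul_le_mul_of_nonneg_left ((le_abs_self _).trans (hgr s (f s)))
      (poissonKernel_pos ht s).le).trans (mul_le_mul_of_nonneg_right (poissonKernel_le ht s) h2)
  refine h1.trans ?_
  rw [integral_const_mul, integral_add (hfp.const_mul C) (integrable_const A), integral_const_mul,
    integral_norm_rpow_eq hp]
  have h3 : ‖f‖ ^ p ≤ 1 := Real.rpow_le_one (norm_nonneg _) hf (by linarith)
  have h4 : 0 < 2 / (1 - ‖t‖) := div_pos two_pos (by linarith)
  refine mul_le_mul_of_nonneg_left ?_ h4.le
  simp
  nlinarith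

/-- The Hardy functions that vanish at `t`, as a subspace of `L^p`. -/
noncomputable def hardyVanishing (n : ℕ) (hp : 1 < p) (ht : t ∈ ball (0 : ℂ) 1) :
    Submodule ℝ (Lp (Cn n) (ENNReal.ofReal p) circleProb) where
  carrier := {f | IsHardy p (f : Circle → Cn n) ∧ poisson (f : Circle → Cn n) t = 0}
  add_mem' {f g} hf hg := by
    have h := Lp.coeFn_add f g
    refine ⟨(hf.1.add hp hg.1).congr_ae h.symm, ?_⟩
    rw [poisson_congr_ae h]
    refine (poisson_add ht (hf.1.integrable hp) (hg.1.integrable hp)).trans ?_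
    rw [hf.2, hg.2, add_zero]
  zero_mem' := by
    have h := Lp.coeFn_zero (Cn n) (ENNReal.ofReal p) circleProb
    have h0 : IsHardy p (fun s : Circle => (fun _ : ℂ => (0 : Cn n)) s) :=
      isHardy_of_differentiable (differentiable_const _)
    refine ⟨h0.congr_ae h.symm, ?_⟩
    rw [poisson_congr_ae h]
    exact poisson_const ht 0
  smul_mem' c f hf := by
    have h := Lp.coeFn_smul c f
    refine ⟨(hf.1.const_smul c).congr_ae h.symm, ?_⟩
    rw [poisson_congr_ae h]
    refine (poisson_const_smul c _).trans ?_
    rw [hf.2, smul_zero]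

theorem toLp_mem_hardyVanishing (hp : 1 < p) (ht : t ∈ ball (0 : ℂ) 1) {f : Circle → Cn n}
    (hf : IsHardy p f) (h0 : poisson f t = 0) :
    hf.1.toLp f ∈ hardyVanishing n hp ht :=
  ⟨hf.congr_ae hf.1.coeFn_toLp.symm, (poisson_congr_ae hf.1.coeFn_toLp).trans h0⟩

theorem poissonKernel_mul_eq (ht : t ∈ ball (0 : ℂ) 1) (s : Circle) :
    (poissonKernel 0 t s : ℂ) * (((s : ℂ) - t) * (1 - (starRingEnd ℂ) t * s)) =
      (1 - ‖t‖ ^ 2 : ℝ) * (s : ℂ) := by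
  have h0 := coe_sub_ne_zero ht s
  have h1 : (‖(s : ℂ) - t‖ : ℂ) ^ 2 = ((s : ℂ) - t) * (starRingEnd ℂ) ((s : ℂ) - t) := by
    rw [Complex.mul_conj, Complex.normSq_eq_norm_sq]; push_cast; rfl
  have h2 : (1 : ℂ) - (starRingEnd ℂ) t * s = (starRingEnd ℂ) ((s : ℂ) - t) * s := by
    have h3 : (starRingEnd ℂ) (s : ℂ) * s = 1 := by
      rw [mul_comm, Complex.mul_conj, Complex.normSq_eq_norm_sq, norm_circle]; simp
    rw [map_sub, sub_mul, h3]
  have h4 : (starRingEnd ℂ) ((s : ℂ) - t) ≠ 0 := (map_ne_zero _).2 h0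
  rw [poissonKernel_zero_apply, Complex.ofReal_div, Complex.ofReal_pow ‖(s : ℂ) - t‖, h1, h2]
  field_simp

/-- A function that annihilates the bounded holomorphic functions vanishing at `t`, with respect to
harmonic measure at `t`, has vanishing negative Fourier coefficients. -/
theorem integral_pow_smul_eq_zero (ht : t ∈ ball (0 : ℂ) 1) {g : Circle → Cn n}
    (hg : Integrable g circleProb)
    (hann : ∀ H : ℂ → Cn n, Differentiable ℂ H → H t = 0 →
      ∫ s : Circle, (poissonKernel 0 t s) * (dot (g s) (H s)).re ∂circleProb = 0) (k : ℕ) :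
    ∫ s : Circle, (s : ℂ) ^ (k + 1) • g s ∂circleProb = 0 := by
  have hi : Integrable (fun s : Circle => (s : ℂ) ^ (k + 1) • g s) circleProb :=
    integrable_continuous_smul (by fun_prop) hg
  have ht2 : (1 - ‖t‖ ^ 2 : ℝ) ≠ 0 := by
    have : ‖t‖ < 1 := by simpa using ht
    nlinarith [norm_nonneg t]
  ext j
  rw [eval_integral_piLp (fun i => hi.eval_piLp i) j]
  have hc : ∀ c : ℂ, ∫ s : Circle, (c * ((s : ℂ) ^ (k + 1) * g s j)).re ∂circleProb = 0 := by
    intro c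
    have h := hann (fun z => EuclideanSpace.single j
      (c * ((z - t) * (1 - (starRingEnd ℂ) t * z)) * z ^ k)) ?_ (by simp)
    · have h1 : ∀ s : Circle, poissonKernel 0 t s * (dot (g s) (EuclideanSpace.single j
          (c * (((s : ℂ) - t) * (1 - (starRingEnd ℂ) t * s)) * (s : ℂ) ^ k))).re =
          (1 - ‖t‖ ^ 2) * (c * ((s : ℂ) ^ (k + 1) * g s j)).re := fun s => by
        rw [← Complex.re_ofReal_mul, ← Complex.re_ofReal_mul]
        congr 1
        have h2 := poissonKernel_mul_eq ht s
        have h3 : dot (g s) (EuclideanSpace.single j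
          (c * (((s : ℂ) - t) * (1 - (starRingEnd ℂ) t * s)) * (s : ℂ) ^ k)) =
          g s j * (c * (((s : ℂ) - t) * (1 - (starRingEnd ℂ) t * s)) * (s : ℂ) ^ k) := by
          simp [dot]
        rw [h3]
        linear_combination (g s j * c * (s : ℂ) ^ k) * h2
      simp only [h1, integral_const_mul] at h
      exact (mul_eq_zero.1 h).resolve_left ht2
    · refine (differentiable_piLp 2).2 fun i => ?_
      by_cases hij : i = j
      · subst hij
        simp only [PiLp.single_apply, if_true]
        fun_prop
      · simp [hij]
  have hij : Integrable (fun s : Circle => (s : ℂ) ^ (k + 1) * g s j) circleProb := hi.eval_piLp j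
  have hre : ∀ c : ℂ, (c * ∫ s : Circle, (s : ℂ) ^ (k + 1) * g s j ∂circleProb).re = 0 := fun c => by
    rw [← integral_const_mul]
    have := integral_re (hij.const_mul c)
    exact this.symm.trans (hc c)
  have h1 := hre 1
  have h2 := hre Complex.I
  rw [one_mul] at h1
  rw [Complex.I_mul_re, neg_eq_zero] at h2
  exact Complex.ext h1 h2

end Duality

section DiscEnvelope

variable {n : ℕ} {p : ℝ} {φ : Circle → Cn n → ℝ} {t : ℂ}

theorem discEnvelope_le {f : Circle → Cn n} (hf : IsHardy p f) :
    discEnvelope p φ t (poisson f t) ≤ (poisson (fun s => φ s (f s)) t : ℝ) :=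
  sInf_le ⟨f, hf, rfl, rfl⟩

theorem exists_discEnvelope_eq_coe (hp : 1 < p)
    (hmeas : Measurable (fun x : Circle × Cn n => φ x.1 x.2)) (hφ : UniformGrowth p φ)
    (ht : t ∈ ball (0 : ℂ) 1) (w : Cn n) : ∃ m : ℝ, discEnvelope p φ t w = m := by
  have hφ' := hφ
  obtain ⟨c, C, A, hc, -, -, h⟩ := hφ'
  have h1 : discEnvelope p φ t w ≤ (poisson (fun s => φ s w) t : ℝ) := by
    have hw : IsHardy p (fun s : Circle => (fun _ : ℂ => w) s) :=
      isHardy_of_differentiable (differentiable_const _)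
    have := discEnvelope_le (φ := φ) (t := t) hw
    rwa [poisson_const ht w] at this
  have h2 : ((-A : ℝ) : EReal) ≤ discEnvelope p φ t w := by
    refine le_sInf ?_
    rintro x ⟨f, hf, -, rfl⟩
    rw [EReal.coe_le_coe_iff, ← poisson_const ht (-A)]
    refine poisson_mono ht (integrable_const _) (integrable_comp hp hmeas hφ hf.1)
      (Eventually.of_forall fun s => ?_)
    have h3 : 0 ≤ c * ‖f s‖ ^ p := mul_nonneg hc.le (Real.rpow_nonneg (norm_nonneg _) _)
    have := (h s (f s)).1
    linarith
  exact ⟨(discEnvelope p φ t w).toReal, (EReal.coe_toReal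
    (h1.trans_lt (EReal.coe_lt_top _)).ne ((EReal.bot_lt_coe _).trans_le h2).ne').symm⟩

theorem le_poissonFunctional_add (hp : 1 < p) (ht : t ∈ ball (0 : ℂ) 1) {w : Cn n} {m : ℝ}
    (hm : m ≤ discEnvelope p φ t w) {f : Lp (Cn n) (ENNReal.ofReal p) circleProb}
    (hf : f ∈ hardyVanishing n hp ht) :
    m ≤ poissonFunctional p φ t ((memLp_const w).toLp (fun _ => w) + f) := by
  have hw : IsHardy p (fun s : Circle => (fun _ : ℂ => w) s) :=
    isHardy_of_differentiable (differentiable_const _)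
  have hs : IsHardy p (fun s : Circle => w + f s) := hw.add hp hf.1
  have h1 : poisson (fun s : Circle => w + f s) t = w := by
    rw [poisson_add ht (integrable_const w) (hf.1.integrable hp), hf.2, poisson_const ht, add_zero]
  have h2 := discEnvelope_le (φ := φ) (t := t) hs
  rw [h1] at h2
  refine (EReal.coe_le_coe_iff.1 (hm.trans h2)).trans_eq (poisson_congr_ae ?_)
  filter_upwards [Lp.coeFn_add ((memLp_const w).toLp (fun _ : Circle => w)) f,
    (memLp_const (p := ENNReal.ofReal p) (μ := circleProb) w).coeFn_toLp] with s h3 h4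
  rw [h3, Pi.add_apply, h4]

theorem dot_smul_left (r : ℝ) (x y : Cn n) : (dot (r • x) y).re = r * (dot x y).re := by
  rw [← reDot_apply, map_smul]; rfl

theorem exists_dual_function (hp : 1 < p)
    (hmeas : Measurable (fun x : Circle × Cn n => φ x.1 x.2))
    (hconv : ∀ s, ConvexOn ℝ univ (φ s)) (hφ : UniformGrowth p φ) (ht : t ∈ ball (0 : ℂ) 1)
    {w : Cn n} {m : ℝ} (hm : m ≤ discEnvelope p φ t w) :
    ∃ g : Circle → Cn n, Measurable g ∧ Integrable g circleProb ∧
      DifferentiableOn ℂ (poisson g) (ball 0 1) ∧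
      ∀ (h : Circle → Cn n), Measurable h → ∀ B : ℝ, (∀ s, ‖h s‖ ≤ B) →
        m + (poisson (fun s => (dot (g s) (h s)).re) t - (dot (poisson g t) w).re) ≤
          poisson (fun s => φ s (h s)) t := by
  have : Fact (1 ≤ ENNReal.ofReal p) :=
    ⟨by rw [← ENNReal.ofReal_one]; exact ENNReal.ofReal_le_ofReal hp.le⟩
  obtain ⟨Λ, hΛ0, hΛ⟩ := exists_affine_le (convexOn_poissonFunctional hp hmeas hconv hφ ht)
    (continuous_poissonFunctional hp hmeas hconv hφ ht) (hardyVanishing n hp ht)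
    ((memLp_const w).toLp (fun _ => w)) fun f hf => le_poissonFunctional_add hp ht hm hf
  obtain ⟨G, hG, hGΛ⟩ := exists_riesz ENNReal.ofReal_ne_top Λ
  have hpos : ∀ s : Circle, poissonKernel 0 t s ≠ 0 := fun s => (poissonKernel_pos ht s).ne'
  have hcinv : Continuous fun s : Circle => (poissonKernel 0 t s)⁻¹ :=
    (continuous_poissonKernel ht).inv₀ hpos
  set g : Circle → Cn n := fun s => (poissonKernel 0 t s)⁻¹ • hG.1.mk G s with hg
  have hgm : Measurable g := hcinv.measurable.smul hG.1.stronglyMeasurable_mk.measurable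
  have hgi : Integrable g circleProb :=
    integrable_continuous_smul hcinv (hG.congr hG.1.ae_eq_mk)
  have hdual : ∀ (h : Circle → Cn n) (hh : Measurable h) (B : ℝ) (hB : ∀ s, ‖h s‖ ≤ B),
      Λ ((MemLp.of_measurable_of_bound hh hB).toLp h) =
        poisson (fun s => (dot (g s) (h s)).re) t := fun h hh B hB => by
    rw [hGΛ h hh B hB]
    refine integral_congr_ae ?_
    filter_upwards [hG.1.ae_eq_mk] with s hs
    rw [hs, hg, dot_smul_left, smul_eq_mul, mul_inv_cancel_left₀ (hpos s)]
  refine ⟨g, hgm, hgi, ?_, fun h hh B hB => ?_⟩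
  · refine differentiableOn_poisson hgi (integral_pow_smul_eq_zero ht hgi fun H hH hH0 => ?_)
    have hc : Continuous (fun s : Circle => H s) := hH.continuous.comp continuous_coe_circle
    obtain ⟨B, hB⟩ := isCompact_univ.exists_bound_of_continuousOn hc.continuousOn
    have h1 := hdual _ hc.measurable B fun s => hB s (mem_univ s)
    have hHt : poisson (fun s : Circle => H s) t = 0 := by
      rw [poisson_of_diffContOnCl hH.diffContOnCl ht, hH0]
    rw [hΛ0 _ (toLp_mem_hardyVanishing hp ht (isHardy_of_differentiable hH) hHt)] at h1
    exact h1.symm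
  · have h1 := hΛ ((MemLp.of_measurable_of_bound hh hB).toLp h)
    have h2 := hdual (fun _ => w) measurable_const ‖w‖ fun _ => le_rfl
    have h3 := poisson_clm ht (reDot w) hgi
    simp only [reDot_apply] at h3
    rw [map_sub, hdual h hh B hB, poissonFunctional_toLp] at h1
    rw [← h3, ← h2]
    exact h1

end DiscEnvelope

section Attained

variable {n : ℕ} {p : ℝ} {φ : Circle → Cn n → ℝ} {t : ℂ}

/-- The pointwise limit of an increasing sequence with bounded integrals is integrable. -/
theorem integrable_of_tendsto_of_monotone {α : Type*} [MeasurableSpace α] {μ : Measure α}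
    {v : ℕ → α → ℝ} {V : α → ℝ} (hv : ∀ k, Integrable (v k) μ)
    (hmono : ∀ s, Monotone fun k => v k s)
    (hlim : ∀ s, Tendsto (fun k => v k s) atTop (𝓝 (V s))) {M : ℝ}
    (hM : ∀ k, ∫ s, v k s ∂μ ≤ M) : Integrable V μ := by
  have hi : ∀ k, Integrable (fun s => v k s - v 0 s) μ := fun k => (hv k).sub (hv 0)
  have hl : ∀ s, Tendsto (fun k => v k s - v 0 s) atTop (𝓝 (V s - v 0 s)) :=
    fun s => (hlim s).sub_const _
  have hle : ∀ k, ∫⁻ s, ‖v k s - v 0 s‖ₑ ∂μ ≤ ENNReal.ofReal (M - ∫ s, v 0 s ∂μ) := fun k => by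
    have h1 : ∀ s, 0 ≤ v k s - v 0 s := fun s => sub_nonneg.2 (hmono s (Nat.zero_le k))
    simp only [Real.enorm_of_nonneg (h1 _)]
    rw [← ofReal_integral_eq_lintegral_ofReal (hi k) (Eventually.of_forall h1),
      integral_sub (hv k) (hv 0)]
    exact ENNReal.ofReal_le_ofReal (sub_le_sub_right (hM k) _)
  have hV : Integrable (fun s => V s - v 0 s) μ := by
    refine ⟨aestronglyMeasurable_of_tendsto_ae _ (fun k => (hi k).1) (Eventually.of_forall hl), ?_⟩
    have h2 : ∫⁻ s, ‖V s - v 0 s‖ₑ ∂μ ≤ liminf (fun k => ∫⁻ s, ‖v k s - v 0 s‖ₑ ∂μ) atTop := by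
      simp only [← ((hl _).enorm).liminf_eq]
      exact lintegral_liminf_le' fun k => (hi k).1.enorm
    refine (h2.trans ?_).trans_lt (ENNReal.ofReal_lt_top (r := M - ∫ s, v 0 s ∂μ))
    exact (liminf_le_liminf (Eventually.of_forall hle)).trans_eq (liminf_const _)
  exact (hV.add (hv 0)).congr (Eventually.of_forall fun s => sub_add_cancel _ _)

/-- Monotone convergence for Poisson integrals. -/
theorem integrable_and_poisson_le_of_monotone (ht : t ∈ ball (0 : ℂ) 1) {v : ℕ → Circle → ℝ}
    {V : Circle → ℝ} (hv : ∀ k, Integrable (v k) circleProb) (hmono : ∀ s, Monotone fun k => v k s)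
    (hlim : ∀ s, Tendsto (fun k => v k s) atTop (𝓝 (V s))) {M : ℝ}
    (hM : ∀ k, poisson (v k) t ≤ M) : Integrable V circleProb ∧ poisson V t ≤ M := by
  have hPmono : ∀ s : Circle, Monotone fun k => poissonKernel 0 t s • v k s := fun s i j hij =>
    mul_le_mul_of_nonneg_left (hmono s hij) (poissonKernel_pos ht s).le
  have hPlim : ∀ s : Circle, Tendsto (fun k => poissonKernel 0 t s • v k s) atTop
      (𝓝 (poissonKernel 0 t s • V s)) := fun s => (hlim s).const_smul _
  have hint : Integrable (fun s : Circle => poissonKernel 0 t s • V s) circleProb :=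
    integrable_of_tendsto_of_monotone (fun k => integrable_poissonKernel_smul ht (hv k)) hPmono
      hPlim hM
  have hV : Integrable V circleProb := by
    have hcinv : Continuous fun s : Circle => (poissonKernel 0 t s)⁻¹ :=
      (continuous_poissonKernel ht).inv₀ fun s => (poissonKernel_pos ht s).ne'
    refine (integrable_continuous_smul hcinv hint).congr (Eventually.of_forall fun s => ?_)
    exact inv_smul_smul₀ (poissonKernel_pos ht s).ne' _
  refine ⟨hV, le_of_tendsto' (integral_tendsto_of_tendsto_of_monotone
    (fun k => integrable_poissonKernel_smul ht (hv k)) hint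
    (Eventually.of_forall hPmono) (Eventually.of_forall hPlim)) hM⟩

theorem discEnvelope_le_linearEnvelope (hp : 1 < p)
    (hmeas : Measurable (fun x : Circle × Cn n => φ x.1 x.2))
    (hconv : ∀ s, ConvexOn ℝ univ (φ s)) (hφ : UniformGrowth p φ) (ht : t ∈ ball (0 : ℂ) 1)
    (w : Cn n) : discEnvelope p φ t w ≤ linearEnvelope p φ t w := by
  obtain ⟨m, hm⟩ := exists_discEnvelope_eq_coe hp hmeas hφ ht w
  obtain ⟨g, hgm, hgi, hgd, hg⟩ := exists_dual_function hp hmeas hconv hφ ht hm.ge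
  have hf : ∀ k, Measurable fun s => dualSelect φ k (s, g s) := fun k =>
    (measurable_dualSelect hmeas k).comp (measurable_id.prodMk hgm)
  choose B hB using exists_norm_dualSelect_le φ
  have hi1 : ∀ k, Integrable (fun s => φ s (dualSelect φ k (s, g s))) circleProb := fun k =>
    integrable_comp hp hmeas hφ (MemLp.of_measurable_of_bound (hf k) fun s => hB k _)
  have hi2 : ∀ k, Integrable (fun s => (dot (g s) (dualSelect φ k (s, g s))).re) circleProb :=
    fun k => by
    refine (hgi.norm.mul_const (B k)).mono'
      (aestronglyMeasurable_re_dot hgi.1 (hf k).aestronglyMeasurable)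
      (Eventually.of_forall fun s => ?_)
    refine (Complex.abs_re_le_norm _).trans ((norm_dot_le _ _).trans ?_)
    exact mul_le_mul_of_nonneg_left (hB k _) (norm_nonneg _)
  obtain ⟨hD, hDle⟩ := integrable_and_poisson_le_of_monotone ht
    (v := fun k s => dualValue φ (s, g s) (dualSelect φ k (s, g s)))
    (V := fun s => dualData φ s (g s)) (M := (dot (poisson g t) w).re - m)
    (fun k => (hi2 k).sub (hi1 k)) (fun s => monotone_dualValue_select (s, g s))
    (fun s => tendsto_dualValue_select hp hφ hconv (s, g s)) fun k => by
      have h1 := hg _ (hf k) (B k) fun s => hB k _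
      have h2 := poisson_sub ht (hi2 k) (hi1 k)
      simp only [dualValue]
      linarith
  have hgL : MemLp g (ENNReal.ofReal (p / (p - 1))) circleProb := by
    obtain ⟨c, _, A, hc, -, -, h⟩ := uniformGrowth_dualData hp hφ
    have hq := one_lt_conj hp
    have hq0 : ENNReal.ofReal (p / (p - 1)) ≠ 0 := by simp; linarith
    rw [← integrable_norm_rpow_iff hgi.1 hq0 ENNReal.ofReal_ne_top,
      ENNReal.toReal_ofReal (by linarith)]
    refine ((hD.add (integrable_const A)).const_mul c⁻¹).mono'
      ((hgm.norm.pow_const _).aestronglyMeasurable) (Eventually.of_forall fun s => ?_)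
    rw [Real.norm_of_nonneg (Real.rpow_nonneg (norm_nonneg _) _), ← div_eq_inv_mul, le_div_iff₀ hc]
    have := (h s (g s)).1
    simp only [Pi.add_apply]
    linarith
  have hf₀ : Integrable (fun s => (dualData φ s (g s) : ℂ)) circleProb := hD.ofReal
  refine le_trans ?_ (le_sSup ⟨fun s => (dualData φ s (g s) : ℂ), g, hf₀, ⟨hgL, hgd⟩,
    (boundaryLE_linFun_iff hf₀ hgi).2 (Eventually.of_forall fun s z => ?_), rfl⟩)
  · rw [hm, EReal.coe_le_coe_iff, linFun]
    simp only [Complex.ofReal_re]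
    linarith
  · have := le_dualData hp hφ s (g s) z
    rw [Complex.ofReal_re]
    linarith

end Attained

section Duality

variable {n : ℕ} {p : ℝ} {φ : Circle → Cn n → ℝ} {t : ℂ}

theorem linearEnvelope_eq_discEnvelope (hp : 1 < p)
    (hmeas : Measurable (fun x : Circle × Cn n => φ x.1 x.2))
    (hconv : ∀ s, ConvexOn ℝ univ (φ s)) (hφ : UniformGrowth p φ) (ht : t ∈ ball (0 : ℂ) 1)
    (w : Cn n) : linearEnvelope p φ t w = discEnvelope p φ t w :=
  ((linearEnvelope_le_perronEnvelope hp φ w).trans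
    (perronEnvelope_le_discEnvelope hp hmeas hφ ht w)).antisymm
    (discEnvelope_le_linearEnvelope hp hmeas hconv hφ ht w)

theorem isInterpolant_discEnvelope (hp : 1 < p)
    (hmeas : Measurable (fun x : Circle × Cn n => φ x.1 x.2))
    (hconv : ∀ s, ConvexOn ℝ univ (φ s)) (hφ : UniformGrowth p φ) :
    IsInterpolant p φ (discEnvelope p φ) := fun _ ht w =>
  ⟨(linearEnvelope_eq_discEnvelope hp hmeas hconv hφ ht w).symm,
    ((discEnvelope_le_linearEnvelope hp hmeas hconv hφ ht w).trans
      (linearEnvelope_le_perronEnvelope hp φ w)).antisymm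
      (perronEnvelope_le_discEnvelope hp hmeas hφ ht w), rfl⟩

theorem linearEnvelope_dualData_le (hp : 1 < p)
    (hmeas : Measurable (fun x : Circle × Cn n => φ x.1 x.2))
    (hconv : ∀ s, ConvexOn ℝ univ (φ s)) (hφ : UniformGrowth p φ) (ht : t ∈ ball (0 : ℂ) 1)
    (z : Cn n) :
    linearEnvelope (p / (p - 1)) (dualData φ) t z ≤ legendre (discEnvelope p φ t) z := by
  refine sSup_le ?_
  rintro x ⟨f₀, f, hf₀, hf, hle, rfl⟩
  rw [conj_conj hp] at hf
  have h1 : ∀ᵐ s ∂circleProb, φ s (f s) ≤ (f₀ s).re := by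
    filter_upwards [(boundaryLE_linFun_iff hf₀ (hf.integrable hp)).1 hle] with s hs
    exact le_of_dualData hp hφ (hconv s) hs
  have h2 := poisson_mono ht (integrable_comp hp hmeas hφ hf.1) (integrable_re hf₀) h1
  have h3 := (discEnvelope_le (φ := φ) (t := t) hf).trans (EReal.coe_le_coe_iff.2 h2)
  refine le_trans ?_ (le_iSup _ (poisson f t))
  rw [linFun, dot_comm, EReal.coe_sub]
  exact EReal.sub_le_sub le_rfl h3

theorem legendre_discEnvelope_le (hp : 1 < p)
    (hmeas : Measurable (fun x : Circle × Cn n => φ x.1 x.2)) (hφ : UniformGrowth p φ)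
    (ht : t ∈ ball (0 : ℂ) 1) (z : Cn n) :
    legendre (discEnvelope p φ t) z ≤ linearEnvelope (p / (p - 1)) (dualData φ) t z := by
  refine iSup_le fun w => ?_
  obtain ⟨m, hm⟩ := exists_discEnvelope_eq_coe hp hmeas hφ ht w
  rw [hm, ← EReal.coe_sub]
  by_contra! hlt
  obtain ⟨b, hb, hbm⟩ := EReal.lt_iff_exists_real_btwn.1 hlt
  have hm2 : discEnvelope p φ t w < (((dot z w).re - b : ℝ) : EReal) := by
    rw [hm, EReal.coe_lt_coe_iff]
    have := EReal.coe_lt_coe_iff.1 hbm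
    linarith
  obtain ⟨x, ⟨f, hf, rfl, rfl⟩, hx⟩ := sInf_lt_iff.1 hm2
  have hi := integrable_comp hp hmeas hφ hf.1
  have hf₀ : Integrable (fun s => (φ s (f s) : ℂ)) circleProb := hi.ofReal
  have hf' : IsHardy (p / (p - 1) / (p / (p - 1) - 1)) f := by rwa [conj_conj hp]
  have hle : BoundaryLE (linFun (fun s => (φ s (f s) : ℂ)) f) (dualData φ) :=
    (boundaryLE_linFun_iff hf₀ (hf.integrable hp)).2 (Eventually.of_forall fun s z => by
      rw [Complex.ofReal_re, dot_comm]
      exact le_dualData hp hφ s z (f s))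
  refine hb.not_ge (le_trans ?_ (le_sSup ⟨_, f, hf₀, hf', hle, rfl⟩))
  rw [EReal.coe_le_coe_iff, linFun, dot_comm]
  have := EReal.coe_lt_coe_iff.1 hx
  simp only [Complex.ofReal_re]
  linarith

theorem discEnvelope_dualData (hp : 1 < p)
    (hmeas : Measurable (fun x : Circle × Cn n => φ x.1 x.2))
    (hconv : ∀ s, ConvexOn ℝ univ (φ s)) (hφ : UniformGrowth p φ) (ht : t ∈ ball (0 : ℂ) 1)
    (z : Cn n) :
    discEnvelope (p / (p - 1)) (dualData φ) t z = legendre (discEnvelope p φ t) z := by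
  rw [← linearEnvelope_eq_discEnvelope (one_lt_conj hp) (measurable_dualData hp hφ hconv hmeas)
    (convexOn_dualData hp hφ) (uniformGrowth_dualData hp hφ) ht]
  exact (linearEnvelope_dualData_le hp hmeas hconv hφ ht z).antisymm
    (legendre_discEnvelope_le hp hmeas hφ ht z)

end Duality

end Interp

theorem mainTheorem4 (n : ℕ) (p : ℝ) (hp : 1 < p) (φ : Circle → Interp.Cn n → ℝ)
    (hmeas : Measurable (fun x : Circle × Interp.Cn n => φ x.1 x.2))
    (hconv : ∀ s : Circle, ConvexOn ℝ Set.univ (φ s))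
    (hgrowth : Interp.UniformGrowth p φ) :
    ∃ Φ Ψ : ℂ → Interp.Cn n → EReal,
      Interp.IsInterpolant p φ Φ ∧
      Interp.IsInterpolant (p / (p - 1)) (Interp.dualData φ) Ψ ∧
      ∀ t ∈ Metric.ball (0 : ℂ) 1, ∀ z : Interp.Cn n,
        Ψ t z = Interp.legendre (Φ t) z :=
  ⟨Interp.discEnvelope p φ, Interp.discEnvelope (p / (p - 1)) (Interp.dualData φ),
    Interp.isInterpolant_discEnvelope hp hmeas hconv hgrowth,
    Interp.isInterpolant_discEnvelope (Interp.one_lt_conj hp)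
      (Interp.measurable_dualData hp hgrowth hconv hmeas) (Interp.convexOn_dualData hp hgrowth)
      (Interp.uniformGrowth_dualData hp hgrowth),
    fun _ ht z => Interp.discEnvelope_dualData hp hmeas hconv hgrowth ht z⟩
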